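/- **Spaces and fans.** Let $d\ge 0$ be an integer and $[n]=\{1,\dots,n\}$. Let $V_d=\{x\in\mathbb R^{d+1}:\sum_i x_i=0\}$, let $W_d=\mathbb R^{d+1}/\mathbb R(1,\dots,1)$ (paired with $V_d$ by the dot product), and for $\alpha\in\mathbb R^{d+1}$ let $U_d^{\alpha}=\{x\in\mathbb R^{d+1}:\sum_i x_i=\sum_i\alpha_i\}$. For a polytope $P$ in a translate of $V_d$ and a nonempty face $F$ of $P$ (the set of maximizers over $P$ of a linear functional), let $\operatorname{ncone}(F,P)=\{w\in W_d:\langle w,y-y'\rangle\ge 0\ \ \forall y\in F,\ y'\in P\}$; the normal fan of $P$ is the set of the cones $\operatorname{ncone}(F,P)$ over all nonempty faces $F$. A fan in $W_d$ is a finite set of polyhedral cones that contains all nonempty faces of its members and in which any two members intersect in a common face. It is complete if its union is $W_d$, and projective if it is the normal fan of a nonempty polytope in a translate of $V_d$. **Trees.** Let $\mathscr T_n$ be the set of plane rooted trees with $n+1$ leaves in which each internal vertex has at least two children, and $\mathscr T_{n,n}\subseteq\mathscr T_n$ the set of those with $n$ internal vertices (the complete binary trees). If $\ell_1,\dots,\ell_{n+1}$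 are the leaves of $\mathrm T\in\mathscr T_n$ from left to right, the closest common ancestor of $\ell_i$ and $\ell_{i+1}$ gets the label $i$; an internal vertex may have several labels. Write $i\preceq_{\mathrm T}j$ if the vertex labeled $j$ is an ancestor of, or equal to, the vertex labeled $i$; this is a preorder on $[n]$. For $\mathrm T\in\mathscr T_{d,d}$ and $\beta\in\mathbb R^d$ put $\beta_{\mathrm T,i}=\sum_{k=1}^{t}\beta_k-\sum_{k=1}^{a}\beta_k-\sum_{k=1}^{b}\beta_k$, where $t,a,b$ are the numbers of internal vertices of the subtree rooted at the vertex labeled $i$, of its left subtree and of its right subtree. **Points.** For $\pi\in\mathfrak S_{d+1}$, $\mathrm T\in\mathscr T_{d,d}$, $\alpha\in\mathbb R^{d+1}$, $\beta\in\mathbb R^d$, let $$v_{\pi,\mathrm T}=\sum_{i=1}^{d+1}\alpha_i e_{\pi^{-1}(i)}+\sum_{i=1}^{d}\beta_{\mathrm T,i}\bigl(e_{\pi^{-1}(i+1)}-e_{\pi^{-1}(i)}\bigr).$$ The pair $(\alpha,\beta)$ is $\mathscr T$-appropriate if $\alpha$ and $\beta$ are strictly increasing and, for every $\mathrm T\in\mathscr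 T_{d,d}$, the coefficient $\alpha_i+\beta_{\mathrm T,i-1}-\beta_{\mathrm T,i}$ of $e_{\pi^{-1}(i)}$ in $v_{\pi,\mathrm T}$ is strictly increasing in $i$ (with $\beta_{\mathrm T,0}=\beta_{\mathrm T,d+1}=0$). In that case let $\operatorname{PermAsso}(\alpha,\beta)$ be the convex hull of all $v_{\pi,\mathrm T}$, $(\pi,\mathrm T)\in\mathfrak S_{d+1}\times\mathscr T_{d,d}$. **Cones.** Let $\mathscr P_d$ be the set of pairs $(\mathcal S,\mathrm T)$ where $\mathcal S=(S_1,\dots,S_k)$ is an ordered partition of $[d+1]$ into $k\ge1$ nonempty blocks and $\mathrm T\in\mathscr T_{k-1}$. Put $t_a=|S_1|+\dots+|S_a|$ and $\operatorname{Type}(\mathcal S)=\{t_1,\dots,t_{k-1}\}$, and let $\preceq_{(\mathcal S,\mathrm T)}$ be the preorder on $\operatorname{Type}(\mathcal S)$ with $t_a\preceq_{(\mathcal S,\mathrm T)} t_b$ if and only if $a\preceq_{\mathrm T}b$. Choose $\pi\in\mathfrak S_{d+1}$ such that $\mathcal S(\pi)=(\{\pi^{-1}(1)\},\dots,\{\pi^{-1}(d+1)\})$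 refines $\mathcal S$ (as ordered partitions), and put $\mathrm D^\pi_i w=w_{\pi^{-1}(i+1)}-w_{\pi^{-1}(i)}$. Then $\sigma(\mathcal S,\mathrm T)$ is the set of those $w\in W_d$ such that $w_i=w_j$ whenever $i,j$ lie in the same block of $\mathcal S$, $\mathrm D^\pi_i w\le\mathrm D^\pi_j w$ whenever $i\preceq_{(\mathcal S,\mathrm T)}j$, and $\mathrm D^\pi_\ell w\ge0$ for each minimal element $\ell$ of $\preceq_{(\mathcal S,\mathrm T)}$; this does not depend on the choice of $\pi$. Write $\sigma(\pi,\mathrm T)=\sigma(\mathcal S(\pi),\mathrm T)$ for $(\pi,\mathrm T)\in\mathfrak S_{d+1}\times\mathscr T_{d,d}$, and $\Xi_d=\{\sigma(\mathcal S,\mathrm T):(\mathcal S,\mathrm T)\in\mathscr P_d\}$ (the nested Loday fan). **Proposition.** Let $(\alpha,\beta)\in\mathbb R^{d+1}\times\mathbb R^d$ be a $\mathscr T$-appropriate pair. 1. $\operatorname{PermAsso}(\alpha,\beta)$ is full-dimensional in $U_d^\alpha$ (its affine hull is $U_d^{\alpha}$), and its vertex set is $\{v_{\pi,\mathrm T}:(\pi,\mathrm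 T)\in\mathfrak S_{d+1}\times\mathscr T_{d,d}\}$. 2. For each $(\pi,\mathrm T)\in\mathfrak S_{d+1}\times\mathscr T_{d,d}$, $\sigma(\pi,\mathrm T)=\operatorname{ncone}(v_{\pi,\mathrm T},\operatorname{PermAsso}(\alpha,\beta))$. 3. The normal fan of $\operatorname{PermAsso}(\alpha,\beta)$ is $\Xi_d$. Hence $\Xi_d$ is a complete projective fan in $W_d$. -/

import Mathlib

noncomputable section

namespace NestedPermAsso

/-! ### Faces, vertices, cones, fans -/

section Polyhedral

variable {E : Type*} [AddCommGroup E] [Module ℝ E]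

/-- `F` is a nonempty face of `P`: the nonempty set of maximizers over `P` of a linear
functional. -/
def IsNonemptyFace (P F : Set E) : Prop :=
  F.Nonempty ∧ ∃ l : Module.Dual ℝ E, F = {x | x ∈ P ∧ ∀ y ∈ P, l y ≤ l x}

/-- The vertices of `P`: the points `v` such that `{v}` is a face of `P`. -/
def vertexSet (P : Set E) : Set E := {v | IsNonemptyFace P {v}}

/-- A polyhedral cone: the solution set of finitely many homogeneous linear inequalities. -/
def IsPolyhedralCone (C : Set E) : Prop :=
  ∃ A : Finset (Module.Dual ℝ E), C = {w | ∀ l ∈ A, 0 ≤ l w}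

/-- A (polyhedral) fan: a finite collection of polyhedral cones that contains every nonempty face
of each of its members, and in which the intersection of two members is a face of both. -/
structure IsFan (Fan : Set (Set E)) : Prop where
  finite : Fan.Finite
  polyhedral : ∀ C ∈ Fan, IsPolyhedralCone C
  face_mem : ∀ C ∈ Fan, ∀ F, IsNonemptyFace C F → F ∈ Fan
  inter_face : ∀ C ∈ Fan, ∀ C' ∈ Fan, IsNonemptyFace C (C ∩ C') ∧ IsNonemptyFace C' (C ∩ C')

/-- A collection of cones is complete if its union is the whole space. -/
def IsCompleteFan (Fan : Set (Set E)) : Prop := ⋃₀ Fan = Set.univ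

end Polyhedral

/-! ### The spaces `V_d`, `W_d`, `U_d^α` and normal fans -/

/-- `V_d`: the vectors of `ℝ^(d+1)` with coordinate sum zero. -/
def V (d : ℕ) : Submodule ℝ (Fin (d + 1) → ℝ) where
  carrier := {x | ∑ i, x i = 0}
  add_mem' := by
    intro x y hx hy
    simp only [Set.mem_ofPred_eq] at hx hy
    simp [Finset.sum_add_distrib, hx, hy]
  zero_mem' := by simp
  smul_mem' := by
    intro c x hx
    simp only [Set.mem_ofPred_eq] at hx
    simp [← Finset.mul_sum, hx]

/-- `W_d`: the quotient of `ℝ^(d+1)` by the line spanned by the all-one vector. -/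
abbrev W (d : ℕ) : Type :=
  (Fin (d + 1) → ℝ) ⧸ Submodule.span ℝ {(1 : Fin (d + 1) → ℝ)}

/-- `U_d^α`: the translate of `V_d` that contains `α`. -/
def U {d : ℕ} (α : Fin (d + 1) → ℝ) : Set (Fin (d + 1) → ℝ) := {x | ∑ i, x i = ∑ i, α i}

/-- The perfect pairing of `W_d` and `V_d` induced by the dot product of `ℝ^(d+1)`. -/
def pairing (d : ℕ) : W d →ₗ[ℝ] V d →ₗ[ℝ] ℝ :=
  Submodule.liftQ _
    (LinearMap.mk₂ ℝ (fun (w : Fin (d + 1) → ℝ) (x : V d) => ∑ i, w i * x.1 i)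
      (by intro w w' x; simp [add_mul, Finset.sum_add_distrib])
      (by intro c w x; simp [Finset.mul_sum, mul_assoc])
      (by intro w x x'; simp [mul_add, Finset.sum_add_distrib])
      (by intro c w x; simp [Finset.mul_sum, mul_left_comm]))
    (by
      rw [Submodule.span_le]
      intro w hw
      rw [Set.mem_singleton_iff] at hw
      subst hw
      rw [SetLike.mem_coe, LinearMap.mem_ker]
      ext x
      have hx : ∑ i, x.1 i = 0 := x.2
      simpa using hx)

/-- The functional `w ↦ w_j - w_i` on `W_d`. -/
def coordDiff {d : ℕ} (i j : Fin (d + 1)) : W d →ₗ[ℝ] ℝ :=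
  Submodule.liftQ _
    ({ toFun := fun w => w j - w i
       map_add' := by intro w w'; simp only [Pi.add_apply]; ring
       map_smul' := by
         intro c w
         simp only [Pi.smul_apply, smul_eq_mul, RingHom.id_apply]
         ring } : (Fin (d + 1) → ℝ) →ₗ[ℝ] ℝ)
    (by
      rw [Submodule.span_le]
      intro w hw
      rw [Set.mem_singleton_iff] at hw
      subst hw
      rw [SetLike.mem_coe, LinearMap.mem_ker]
      exact sub_self (1 : ℝ))

/-- The normal cone of `P` at `F`, where `F ⊆ P` and `P` lies in a translate of `V_d` (so that all
differences `y - y'` below are in `V_d`): the `w` with `⟨w, y⟩ ≥ ⟨w, y'⟩` for all `y ∈ F`,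
`y' ∈ P`. -/
def ncone {d : ℕ} (F P : Set (Fin (d + 1) → ℝ)) : Set (W d) :=
  {w | ∀ y ∈ F, ∀ y' ∈ P, ∀ h : y - y' ∈ V d, 0 ≤ pairing d w ⟨y - y', h⟩}

/-- The normal fan of `P`: the normal cones at all nonempty faces of `P`. -/
def normalFan {d : ℕ} (P : Set (Fin (d + 1) → ℝ)) : Set (Set (W d)) :=
  {C | ∃ F, IsNonemptyFace P F ∧ C = ncone F P}

/-- A collection of cones in `W_d` is projective if it is the normal fan of a (nonempty) polytope
lying in a translate of `V_d`. -/
def IsProjective {d : ℕ} (Fan : Set (Set (W d))) : Prop :=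
  ∃ (a : Fin (d + 1) → ℝ) (s : Finset (Fin (d + 1) → ℝ)),
    s.Nonempty ∧ (s : Set (Fin (d + 1) → ℝ)) ⊆ U a ∧
      normalFan (convexHull ℝ (s : Set (Fin (d + 1) → ℝ))) = Fan

/-! ### Strictly branching plane rooted trees -/

/-- Unlabeled plane rooted trees that are strictly branching: a tree is a single vertex (a leaf), or
a root with a linearly ordered family of at least two subtrees. -/
inductive PlaneTree : Type
  | leaf : PlaneTree
  | node (k : ℕ) (child : Fin (k + 2) → PlaneTree) : PlaneTree

namespace PlaneTree

/-- The number of leaves. -/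
def numLeaves : PlaneTree → ℕ
  | leaf => 1
  | node _ c => ∑ j, (c j).numLeaves

/-- The number of internal vertices. -/
def numInternal : PlaneTree → ℕ
  | leaf => 0
  | node _ c => 1 + ∑ j, (c j).numInternal

/-- The leaves of a tree in left-to-right order. A vertex is encoded by the path that leads from the
root to it, the list of the positions of the children that one descends to. -/
def leafPaths : PlaneTree → List (List ℕ)
  | leaf => [[]]
  | node k c => (List.finRange (k + 2)).flatMap fun j => (c j).leafPaths.map (j.val :: ·)

/-- The longest common prefix of two paths: the closest common ancestor of two vertices. -/
def commonAncestor : List ℕ → List ℕ → List ℕ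
  | a :: p, b :: q => if a = b then a :: commonAncestor p q else []
  | _, _ => []

/-- The internal vertex carrying the label `i + 1`, namely the closest common ancestor of the
consecutive leaves `ℓ_{i+1}` and `ℓ_{i+2}` (leaves are counted from `1`, lists from `0`). It is
meaningful for `i + 1 < numLeaves T`. -/
def labelVertex (T : PlaneTree) (i : ℕ) : List ℕ :=
  commonAncestor (T.leafPaths.getD i []) (T.leafPaths.getD (i + 1) [])

/-- The subtree rooted at the vertex with the given path. -/
def subtreeAt : PlaneTree → List ℕ → PlaneTree
  | T, [] => T
  | leaf, _ :: _ => leaf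
  | node k c, a :: p => if h : a < k + 2 then (c ⟨a, h⟩).subtreeAt p else leaf

/-- The preorder `≼_T` on labels, whose Hasse diagram is the tree of internal vertices with the root
on top: `i ≼_T j` if the vertex labeled by `j` is an ancestor of, or equal to, the vertex labeled
by `i`. Labels are shifted by one as in `labelVertex`. -/
def labelLE (T : PlaneTree) (i j : ℕ) : Prop := T.labelVertex j <+: T.labelVertex i

end PlaneTree

/-- `𝒯_n`: the strictly branching plane rooted trees with `n + 1` leaves. -/
def trees (n : ℕ) : Set PlaneTree := {T | T.numLeaves = n + 1}

/-- `𝒯_{n,k}`: the trees in `𝒯_n` with `k` internal vertices. In particular `𝒯_{n,n}` consists of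
the complete binary trees with `n + 1` leaves. -/
def treesInternal (n k : ℕ) : Set PlaneTree := {T | T ∈ trees n ∧ T.numInternal = k}

/-- The sum of the first `t` entries of `β`. -/
def prefixSum {n : ℕ} (β : Fin n → ℝ) (t : ℕ) : ℝ :=
  ∑ k ∈ Finset.univ.filter (fun k : Fin n => k.val < t), β k

/-- `val(β, T)`: the sum of the first `t` entries of `β`, where `t` is the number of internal
vertices of `T`, minus the same quantity for each of the subtrees below the root (for a binary tree,
the Left and the Right subtree). -/
def treeVal {n : ℕ} (β : Fin n → ℝ) : PlaneTree → ℝ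
  | .leaf => 0
  | .node k c =>
      prefixSum β (PlaneTree.node k c).numInternal - ∑ j, prefixSum β (c j).numInternal

/-! ### Ordered partitions and partition labeled trees -/

/-- Ordered set partitions of `{0, …, n - 1}` with `k` (nonempty) blocks. -/
structure OrderedPartition (n k : ℕ) where
  block : Fin k → Finset (Fin n)
  nonempty : ∀ a, (block a).Nonempty
  disjoint : ∀ a b, a ≠ b → Disjoint (block a) (block b)
  cover : ∀ i, ∃ a, i ∈ block a

/-- `R` refines `S` as ordered partitions: each block of `R` lies in a block of `S`, compatibly with
the orders of the blocks. -/
def OrderedPartition.Refines {n k l : ℕ} (R : OrderedPartition n k) (S : OrderedPartition n l) :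
    Prop :=
  ∃ f : Fin k → Fin l, Monotone f ∧ ∀ a, R.block a ⊆ S.block (f a)

/-- `𝒮(π) = ({π⁻¹(1)}, {π⁻¹(2)}, …)`. -/
def permPartition {n : ℕ} (π : Equiv.Perm (Fin n)) : OrderedPartition n n where
  block a := {π.symm a}
  nonempty a := Finset.singleton_nonempty _
  disjoint a b h := by simpa using h
  cover i := ⟨π i, by simp⟩

/-- The entry `t_{a+1} = |S_1| + ⋯ + |S_{a+1}|` of the type of `S = (S_1, …, S_{m+1})`. -/
def OrderedPartition.typeEntry {n m : ℕ} (S : OrderedPartition n (m + 1)) (a : Fin m) : ℕ :=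
  ∑ b ∈ Finset.univ.filter (fun b : Fin (m + 1) => b.val ≤ a.val), (S.block b).card

/-- `𝒫_d`: pairs of an ordered partition of `[d+1]` and a strictly branching tree with as many
leaves as the partition has blocks. (There are at most `d + 1` blocks, as blocks are nonempty.) -/
structure PartitionLabeledTree (d : ℕ) where
  m : ℕ
  partition : OrderedPartition (d + 1) (m + 1)
  tree : PlaneTree
  tree_mem : tree ∈ trees m

/-- The preorder `≼_(𝒮,T)` on the set `Type(𝒮)`, obtained from `≼_T` by replacing the label `a` with
`t_a`. Elements of `{1, …, d}` are represented by `Fin d`, shifted by one. -/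
def PartitionLabeledTree.typeLE {d : ℕ} (X : PartitionLabeledTree d) (i j : Fin d) : Prop :=
  ∃ a b : Fin X.m, X.partition.typeEntry a = i.val + 1 ∧ X.partition.typeEntry b = j.val + 1 ∧
    X.tree.labelLE a.val b.val

/-- `i` is an element of `Type(𝒮)` that is minimal for `≼_(𝒮,T)`. -/
def PartitionLabeledTree.IsMinimalType {d : ℕ} (X : PartitionLabeledTree d) (i : Fin d) : Prop :=
  (∃ a : Fin X.m, X.partition.typeEntry a = i.val + 1) ∧ ∀ j, X.typeLE j i → X.typeLE i j

/-- `D^π_i w = w_{π⁻¹(i+1)} - w_{π⁻¹(i)}`. -/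
def D {d : ℕ} (π : Equiv.Perm (Fin (d + 1))) (i : Fin d) : W d →ₗ[ℝ] ℝ :=
  coordDiff (π.symm i.castSucc) (π.symm i.succ)

/-- The cone `σ(𝒮,T)`: those `w` that are constant on the blocks of `𝒮` and satisfy, for a `π` such
that `𝒮(π)` refines `𝒮`, the inequalities `D^π_i w ≤ D^π_j w` for `i ≼_(𝒮,T) j`, and `D^π_i w ≥ 0`
for `i` minimal. The choice of `π` does not matter. -/
def PartitionLabeledTree.cone {d : ℕ} (X : PartitionLabeledTree d) : Set (W d) :=
  {w | (∀ a, ∀ i ∈ X.partition.block a, ∀ j ∈ X.partition.block a, coordDiff i j w = 0) ∧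
    ∃ π : Equiv.Perm (Fin (d + 1)), (permPartition π).Refines X.partition ∧
      (∀ i j, X.typeLE i j → D π i w ≤ D π j w) ∧
      (∀ i, X.IsMinimalType i → 0 ≤ D π i w)}

/-- The nested Loday fan `Ξ_d = {σ(𝒮,T) : (𝒮,T) ∈ 𝒫_d}`. -/
def nestedLodayFan (d : ℕ) : Set (Set (W d)) := Set.range (PartitionLabeledTree.cone (d := d))

/-- `σ(π,T) = σ(𝒮(π),T)`. -/
def permCone {d : ℕ} (π : Equiv.Perm (Fin (d + 1))) (T : PlaneTree) (hT : T ∈ trees d) :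
    Set (W d) :=
  PartitionLabeledTree.cone ⟨d, permPartition π, T, hT⟩

/-! ### The nested permuto-associahedron -/

/-- `f^π_i = e_{π⁻¹(i+1)} - e_{π⁻¹(i)}`. -/
def fvec {d : ℕ} (π : Equiv.Perm (Fin (d + 1))) (i : Fin d) : Fin (d + 1) → ℝ :=
  Pi.single (π.symm i.succ) 1 - Pi.single (π.symm i.castSucc) 1

/-- `β_{T,i} = val(β, T_(i))`, where `T_(i)` is the subtree of `T` rooted at the internal vertex
labeled by `i` (labels shifted by one). -/
def treeCoeff {d : ℕ} (β : Fin d → ℝ) (T : PlaneTree) (i : Fin d) : ℝ :=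
  treeVal β (T.subtreeAt (T.labelVertex i.val))

/-- `v_{π,T} = ∑ α_i e_{π⁻¹(i)} + ∑ β_{T,i} f^π_i`. -/
def vpt {d : ℕ} (α : Fin (d + 1) → ℝ) (β : Fin d → ℝ) (π : Equiv.Perm (Fin (d + 1)))
    (T : PlaneTree) : Fin (d + 1) → ℝ :=
  ∑ i, α i • Pi.single (π.symm i) 1 + ∑ i, treeCoeff β T i • fvec π i

/-- `(α, β)` is a `𝒯`-appropriate pair of strictly increasing sequences: for every complete binary
tree `T` with `d + 1` leaves, the coefficient of `e_{π⁻¹(i)}` in `v_{π,T}` is strictly increasing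
in `i` (this coefficient does not depend on `π`). -/
structure IsTreeAppropriate {d : ℕ} (α : Fin (d + 1) → ℝ) (β : Fin d → ℝ) : Prop where
  strictMono_fst : StrictMono α
  strictMono_snd : StrictMono β
  strictMono_coeff : ∀ T ∈ treesInternal d d, ∀ π : Equiv.Perm (Fin (d + 1)),
    StrictMono fun i => vpt α β π T (π.symm i)

/-- The set of all points `v_{π,T}`, with `π` a permutation of `[d+1]` and `T` a complete binary
tree with `d + 1` leaves. -/
def permAssoPoints {d : ℕ} (α : Fin (d + 1) → ℝ) (β : Fin d → ℝ) : Set (Fin (d + 1) → ℝ) :=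
  {x | ∃ π : Equiv.Perm (Fin (d + 1)), ∃ T ∈ treesInternal d d, x = vpt α β π T}

/-- The nested permuto-associahedron. -/
def permAsso {d : ℕ} (α : Fin (d + 1) → ℝ) (β : Fin d → ℝ) : Set (Fin (d + 1) → ℝ) :=
  convexHull ℝ (permAssoPoints α β)

end NestedPermAsso

end

open NestedPermAsso

/-!
Let `w` be sorted by `π`. The functional `w` takes the value `(w ∘ π⁻¹) · α + ∑ i, β_{T,i} g_i` at
`v_{π,T}`, where `g` is the vector of gaps of the sorted vector. The coefficients `β_{T,i}` are
those of a vertex of a Minkowski sum of simplices, one for each interval of labels, with the second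
differences of the partial sums of `β` as weights. These weights are positive for every interval of
at least two labels, so the second sum is maximal exactly if, for every interval, the gap at the
topmost label is the largest one, that is, if the gaps increase towards the root of `T`. The
coordinates of `v_{1,T}` being increasing, the rearrangement inequality gives the corresponding
statement for `π`. So the points that maximize `w` are the `v_{π,T}` such that `π` sorts `w` and the
gaps increase towards the root of `T`.

It follows that `w'` lies in the normal cone at the face of maximizers of `w` if and only if every
pair `(π, T)` that fits `w` fits `w'`. This describes `σ(𝒮,T)` if the level sets of `w` are the
blocks of `𝒮` and `T` is the Cartesian tree of its gaps, and every `w` is of this form.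
-/

namespace NestedPermAsso

namespace PlaneTree

/-! ### Closest common ancestors of leaves -/

@[simp] theorem commonAncestor_nil_left (p : List ℕ) : commonAncestor [] p = [] := by
  simp only [commonAncestor]

@[simp] theorem commonAncestor_nil_right (p : List ℕ) : commonAncestor p [] = [] := by
  cases p <;> simp only [commonAncestor]

theorem commonAncestor_cons_cons (a b : ℕ) (p q : List ℕ) :
    commonAncestor (a :: p) (b :: q) = if a = b then a :: commonAncestor p q else [] := by
  simp only [commonAncestor]

theorem commonAncestor_comm (p q : List ℕ) : commonAncestor p q = commonAncestor q p := by
  induction p generalizing q with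
  | nil => simp
  | cons a p ih =>
    cases q with
    | nil => simp
    | cons b q =>
      simp only [commonAncestor_cons_cons, ih q, eq_comm (a := a)]
      split_ifs with h
      · rw [h]
      · rfl

theorem commonAncestor_prefix_left (p q : List ℕ) : commonAncestor p q <+: p := by
  induction p generalizing q with
  | nil => simp
  | cons a p ih =>
    cases q with
    | nil => simp
    | cons b q =>
      rw [commonAncestor_cons_cons]
      split_ifs
      · simpa using ih q
      · simp

theorem commonAncestor_prefix_right (p q : List ℕ) : commonAncestor p q <+: q :=
  commonAncestor_comm p q ▸ commonAncestor_prefix_left q p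

theorem prefix_commonAncestor {s p q : List ℕ} (hp : s <+: p) (hq : s <+: q) :
    s <+: commonAncestor p q := by
  induction s generalizing p q with
  | nil => simp
  | cons a s ih =>
    obtain ⟨p, rfl⟩ := hp
    obtain ⟨q, rfl⟩ := hq
    simp only [List.cons_append, commonAncestor_cons_cons, if_true, List.cons_prefix_cons,
      true_and]
    exact ih (by simp) (by simp)

theorem commonAncestor_of_lt_of_lt {p q r : List ℕ} (hpq : p < q) (hqr : q < r) :
    (commonAncestor p r = commonAncestor p q ∧ commonAncestor p q <+: commonAncestor q r) ∨
      (commonAncestor p r = commonAncestor q r ∧ commonAncestor q r <+: commonAncestor p q) := by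
  induction p generalizing q r with
  | nil => simp
  | cons a p ih =>
    cases q with
    | nil => simp at hpq
    | cons b q =>
      cases r with
      | nil => simp at hqr
      | cons c r =>
        simp only [List.cons_lt_cons_iff] at hpq hqr
        simp only [commonAncestor_cons_cons]
        rcases hpq with hab | ⟨rfl, hpq⟩ <;> rcases hqr with hbc | ⟨rfl, hqr⟩
        · simp [hab.ne, hbc.ne, (hab.trans hbc).ne]
        · simp [hab.ne]
        · simp [hbc.ne]
        · simpa using ih hpq hqr

theorem length_leafPaths (T : PlaneTree) : T.leafPaths.length = T.numLeaves := by
  induction T with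
  | leaf => simp only [leafPaths, numLeaves, List.length_singleton]
  | node k c ih => simp [leafPaths, numLeaves, List.length_flatMap, ih, Fin.sum_univ_def]

theorem numInternal_lt_numLeaves (T : PlaneTree) : T.numInternal < T.numLeaves := by
  induction T with
  | leaf => simp [numInternal, numLeaves]
  | node k c ih =>
    have h : ∑ j, ((c j).numInternal + 1) ≤ ∑ j, (c j).numLeaves :=
      Finset.sum_le_sum fun j _ => ih j
    simp only [Finset.sum_add_distrib, Finset.sum_const, Finset.card_univ, Fintype.card_fin,
      smul_eq_mul, mul_one] at h
    simp only [numInternal, numLeaves]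
    omega

theorem numLeaves_pos (T : PlaneTree) : 0 < T.numLeaves :=
  (Nat.zero_le _).trans_lt T.numInternal_lt_numLeaves

theorem leafPaths_ne_nil (T : PlaneTree) : T.leafPaths ≠ [] := by
  rw [← List.length_pos_iff, length_leafPaths]
  exact T.numLeaves_pos

theorem pairwise_lt_leafPaths (T : PlaneTree) : T.leafPaths.Pairwise (· < ·) := by
  induction T with
  | leaf => simp [leafPaths]
  | node k c ih =>
    rw [leafPaths, List.pairwise_flatMap]
    refine ⟨fun j _ => ?_, ?_⟩
    · rw [List.pairwise_map]
      exact (ih j).imp fun h => List.cons_lt_cons_iff.2 (Or.inr ⟨rfl, h⟩)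
    · refine (List.pairwise_lt_finRange (k + 2)).imp fun {i j} hij p hp q hq => ?_
      simp only [List.mem_map] at hp hq
      obtain ⟨p, -, rfl⟩ := hp
      obtain ⟨q, -, rfl⟩ := hq
      exact List.cons_lt_cons_iff.2 (Or.inl hij)

/-- The closest common ancestor of the consecutive entries `i` and `i + 1` of a list of paths, so
that `T.labelVertex i = gapPath T.leafPaths i`. -/
def gapPath (L : List (List ℕ)) (i : ℕ) : List ℕ :=
  commonAncestor (L.getD i []) (L.getD (i + 1) [])

theorem getD_lt_getD {L : List (List ℕ)} (hL : L.Pairwise (· < ·)) {i j : ℕ} (hij : i < j)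
    (hj : j < L.length) : L.getD i [] < L.getD j [] := by
  rw [List.getD_eq_getElem _ _ hj, List.getD_eq_getElem _ _ (hij.trans hj)]
  exact List.pairwise_iff_getElem.1 hL i j _ _ hij

theorem exists_gapPath_eq_commonAncestor {L : List (List ℕ)} (hL : L.Pairwise (· < ·)) {i j : ℕ}
    (hij : i ≤ j) (hj : j + 1 < L.length) :
    ∃ m ∈ Set.Icc i j, gapPath L m = commonAncestor (L.getD i []) (L.getD (j + 1) []) ∧
      ∀ k ∈ Set.Icc i j, gapPath L m <+: gapPath L k := by
  induction j, hij using Nat.le_induction with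
  | base =>
    refine ⟨i, ⟨le_rfl, le_rfl⟩, rfl, fun k hk => ?_⟩
    rw [le_antisymm hk.1 hk.2]
  | succ j hij ih =>
    obtain ⟨m, ⟨him, hmj⟩, hm, hmin⟩ := ih (by omega)
    rcases commonAncestor_of_lt_of_lt (getD_lt_getD hL (show i < j + 1 by omega) (by omega))
      (getD_lt_getD hL (Nat.lt_succ_self (j + 1)) hj) with ⟨heq, hle⟩ | ⟨heq, hle⟩
    · refine ⟨m, ⟨him, by omega⟩, hm.trans heq.symm, fun k hk => ?_⟩
      rcases Nat.le_succ_iff.1 hk.2 with hkj | rfl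
      · exact hmin k ⟨hk.1, hkj⟩
      · exact hm ▸ hle
    · refine ⟨j + 1, ⟨by omega, le_rfl⟩, heq.symm, fun k hk => ?_⟩
      rcases Nat.le_succ_iff.1 hk.2 with hkj | rfl
      · exact hle.trans (hm ▸ hmin k ⟨hk.1, hkj⟩)
      · exact List.prefix_rfl

/-! ### The preorder on labels -/

theorem labelLE_refl (T : PlaneTree) (i : ℕ) : T.labelLE i i := List.prefix_rfl

theorem labelLE.trans {T : PlaneTree} {i j k : ℕ} (hij : T.labelLE i j) (hjk : T.labelLE j k) :
    T.labelLE i k := List.IsPrefix.trans hjk hij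

theorem labelLE_of_labelVertex_eq_nil {T : PlaneTree} {j : ℕ} (hj : T.labelVertex j = [])
    (i : ℕ) : T.labelLE i j := by
  rw [labelLE, hj]
  exact List.nil_prefix

variable {n : ℕ} {T : PlaneTree}

theorem exists_labelVertex_eq_commonAncestor (hT : T ∈ trees n) {i j : Fin n} (hij : i ≤ j) :
    ∃ m ∈ Set.Icc i j, T.labelVertex m =
        commonAncestor (T.leafPaths.getD i []) (T.leafPaths.getD (j + 1) []) ∧
      ∀ k ∈ Set.Icc i j, T.labelLE k m := by
  have hlen : T.leafPaths.length = n + 1 := T.length_leafPaths.trans hT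
  obtain ⟨m, ⟨him, hmj⟩, hm, hmin⟩ := exists_gapPath_eq_commonAncestor T.pairwise_lt_leafPaths
    (Fin.le_def.1 hij) (by omega)
  exact ⟨⟨m, hmj.trans_lt j.2⟩, ⟨him, hmj⟩, hm, fun k hk => hmin k hk⟩

theorem exists_forall_labelLE (hT : T ∈ trees n) (i j : Fin n) :
    ∃ m ∈ Set.uIcc i j, ∀ k ∈ Set.uIcc i j, T.labelLE k m := by
  wlog hij : i ≤ j generalizing i j
  · rw [Set.uIcc_comm]
    exact this j i (le_of_not_ge hij)
  rw [Set.uIcc_of_le hij]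
  obtain ⟨m, hm, -, hmax⟩ := exists_labelVertex_eq_commonAncestor hT hij
  exact ⟨m, hm, hmax⟩

theorem labelLE_of_mem_uIcc (hT : T ∈ trees n) {i j k : Fin n} (hij : T.labelLE i j)
    (hk : k ∈ Set.uIcc i j) : T.labelLE k j := by
  have hleft : ∀ l, T.labelVertex l <+: T.leafPaths.getD l [] :=
    fun l => commonAncestor_prefix_left _ _
  have hright : ∀ l, T.labelVertex l <+: T.leafPaths.getD (l + 1) [] :=
    fun l => commonAncestor_prefix_right _ _
  rcases le_total i j with h | h
  · rw [Set.uIcc_of_le h] at hk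
    obtain ⟨m, -, hm, hmax⟩ := exists_labelVertex_eq_commonAncestor hT h
    refine (hmax k hk).trans ?_
    rw [labelLE, hm]
    exact prefix_commonAncestor (List.IsPrefix.trans hij (hleft i)) (hright j)
  · rw [Set.uIcc_of_ge h] at hk
    obtain ⟨m, -, hm, hmax⟩ := exists_labelVertex_eq_commonAncestor hT h
    refine (hmax k hk).trans ?_
    rw [labelLE, hm]
    exact prefix_commonAncestor (hleft j) (List.IsPrefix.trans hij (hright i))

/-! ### Grafting -/

theorem gapPath_append_left {L M : List (List ℕ)} {i : ℕ} (hi : i + 1 < L.length) :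
    gapPath (L ++ M) i = gapPath L i := by
  rw [gapPath, List.getD_append _ _ _ _ hi, List.getD_append _ _ _ _ (by omega), gapPath]

theorem gapPath_append_right (L M : List (List ℕ)) (i : ℕ) :
    gapPath (L ++ M) (L.length + i) = gapPath M i := by
  rw [gapPath, add_assoc, List.getD_append_right _ _ _ _ (by omega),
    List.getD_append_right _ _ _ _ (by omega), Nat.add_sub_cancel_left, Nat.add_sub_cancel_left,
    gapPath]

theorem gapPath_append_mid {L M : List (List ℕ)} {i : ℕ} (hi : i + 1 = L.length) (hM : M ≠ [])
    (h : ∀ p ∈ L, ∀ q ∈ M, commonAncestor p q = []) : gapPath (L ++ M) i = [] := by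
  have hpos : 0 < M.length := List.length_pos_iff.2 hM
  rw [gapPath, List.getD_append _ _ _ _ (by omega), List.getD_append_right _ _ _ _ (by omega),
    List.getD_eq_getElem _ _ (by omega), List.getD_eq_getElem _ _ (by omega)]
  exact h _ (List.getElem_mem _) _ (List.getElem_mem _)

theorem gapPath_map {φ : List ℕ → List ℕ}
    (hφ : ∀ p q, commonAncestor (φ p) (φ q) = φ (commonAncestor p q)) {L : List (List ℕ)} {i : ℕ}
    (hi : i + 1 < L.length) : gapPath (L.map φ) i = φ (gapPath L i) := by
  have hi' : i < L.length := by omega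
  rw [gapPath, List.getD_eq_getElem _ _ (by simpa using hi'),
    List.getD_eq_getElem _ _ (by simpa using hi), gapPath, List.getD_eq_getElem _ _ hi',
    List.getD_eq_getElem _ _ hi, List.getElem_map, List.getElem_map, hφ]

/-- `T` is obtained by attaching `A` as the leftmost child of the root to the tree `B`, the vertex
of `B` with path `p` becoming the vertex of `T` with path `φ p`. There are two instances: either the
root of `T` is a new binary vertex with children `A` and `B` (and `φ` prepends `1`), or the root of
`T` is the root of `B` (and `φ` increases the first entry of a path). -/
structure IsGraft (φ : List ℕ → List ℕ) (A B T : PlaneTree) : Prop where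
  leafPaths_eq : T.leafPaths = A.leafPaths.map (0 :: ·) ++ B.leafPaths.map φ
  commonAncestor_map : ∀ p q, commonAncestor (φ p) (φ q) = φ (commonAncestor p q)
  map_prefix_map : ∀ p q, φ p <+: φ q ↔ p <+: q
  map_ne_zero_cons : ∀ p q, φ p ≠ 0 :: q

/-- Increases the first entry of a path: a new leftmost child of the root shifts all the others. -/
def bump : List ℕ → List ℕ
  | [] => []
  | a :: p => (a + 1) :: p

@[simp] theorem bump_eq_nil {p : List ℕ} : bump p = [] ↔ p = [] := by
  cases p <;> simp [bump]

theorem isGraft_node_zero (c : Fin 2 → PlaneTree) : IsGraft (1 :: ·) (c 0) (c 1) (node 0 c) where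
  leafPaths_eq := by simp [leafPaths, List.finRange_succ]
  commonAncestor_map p q := by simp [commonAncestor_cons_cons]
  map_prefix_map p q := by simp
  map_ne_zero_cons p q := by simp

theorem isGraft_node_cons {k : ℕ} (A : PlaneTree) (c : Fin (k + 2) → PlaneTree) :
    IsGraft bump A (node k c) (node (k + 1) (Fin.cons A c : Fin (k + 3) → PlaneTree)) where
  leafPaths_eq := by
    simp only [leafPaths]
    rw [List.finRange_succ, List.flatMap_cons, List.flatMap_map, List.map_flatMap]
    congr 1
    exact List.flatMap_congr fun j _ => by simp [bump, Function.comp_def]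
  commonAncestor_map p q := by
    cases p <;> cases q <;> simp [bump, commonAncestor_cons_cons]
    split_ifs <;> rfl
  map_prefix_map p q := by cases p <;> cases q <;> simp [bump]
  map_ne_zero_cons p q := by cases p <;> simp [bump]

namespace IsGraft

variable {φ : List ℕ → List ℕ} {A B T : PlaneTree} {a b : ℕ}

theorem commonAncestor_zero_cons_map (h : IsGraft φ A B T) (p q : List ℕ) :
    commonAncestor (0 :: p) (φ q) = [] := by
  cases hq : φ q with
  | nil => simp
  | cons x s =>
    have hx : 0 ≠ x := by
      rintro rfl
      exact h.map_ne_zero_cons q s hq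
    rw [commonAncestor_cons_cons, if_neg hx]

theorem mem_trees (h : IsGraft φ A B T) (hA : A ∈ trees a) (hB : B ∈ trees b) :
    T ∈ trees (a + 1 + b) := by
  have hlen := congrArg List.length h.leafPaths_eq
  simp only [List.length_append, List.length_map, length_leafPaths] at hlen
  simp only [trees, Set.mem_ofPred_eq] at hA hB ⊢
  omega

theorem labelVertex_left (h : IsGraft φ A B T) (hA : A ∈ trees a) {i : ℕ} (hi : i < a) :
    T.labelVertex i = 0 :: A.labelVertex i := by
  have hlen : A.leafPaths.length = a + 1 := A.length_leafPaths.trans hA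
  change gapPath T.leafPaths i = _
  rw [h.leafPaths_eq, gapPath_append_left (by rw [List.length_map]; omega),
    gapPath_map (fun p q => by simp [commonAncestor_cons_cons]) (by omega)]
  rfl

theorem labelVertex_root (h : IsGraft φ A B T) (hA : A ∈ trees a) : T.labelVertex a = [] := by
  change gapPath T.leafPaths a = _
  rw [h.leafPaths_eq]
  refine gapPath_append_mid ?_ (by simp [leafPaths_ne_nil]) fun p hp q hq => ?_
  · rw [List.length_map, length_leafPaths]
    exact hA.symm
  · simp only [List.mem_map] at hp hq
    obtain ⟨p, -, rfl⟩ := hp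
    obtain ⟨q, -, rfl⟩ := hq
    exact h.commonAncestor_zero_cons_map p q

theorem labelVertex_right (h : IsGraft φ A B T) (hA : A ∈ trees a) (hB : B ∈ trees b) {i : ℕ}
    (hi : i < b) : T.labelVertex (a + 1 + i) = φ (B.labelVertex i) := by
  have hlenA : (A.leafPaths.map (0 :: ·)).length = a + 1 := by
    rw [List.length_map, length_leafPaths]
    exact hA
  have hlenB : B.leafPaths.length = b + 1 := B.length_leafPaths.trans hB
  change gapPath T.leafPaths (a + 1 + i) = _
  rw [h.leafPaths_eq, ← hlenA, gapPath_append_right, gapPath_map h.commonAncestor_map (by omega)]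
  rfl

theorem labelLE_left_iff (h : IsGraft φ A B T) (hA : A ∈ trees a) {i j : ℕ} (hi : i < a)
    (hj : j < a) : T.labelLE i j ↔ A.labelLE i j := by
  rw [labelLE, h.labelVertex_left hA hi, h.labelVertex_left hA hj, List.cons_prefix_cons,
    and_iff_right rfl, labelLE]

theorem labelLE_right_iff (h : IsGraft φ A B T) (hA : A ∈ trees a) (hB : B ∈ trees b) {i j : ℕ}
    (hi : i < b) (hj : j < b) : T.labelLE (a + 1 + i) (a + 1 + j) ↔ B.labelLE i j := by
  rw [labelLE, h.labelVertex_right hA hB hi, h.labelVertex_right hA hB hj, h.map_prefix_map,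
    labelLE]

end IsGraft

theorem exists_labelVertex_eq_nil {n : ℕ} {T : PlaneTree} (hT : T ∈ trees n) (hn : 0 < n) :
    ∃ m < n, T.labelVertex m = [] := by
  cases T with
  | leaf => exact absurd (Nat.succ_injective hT) hn.ne
  | node k c =>
    obtain ⟨φ, B, h⟩ : ∃ φ B, IsGraft φ (c 0) B (node k c) := by
      rcases k with _ | k
      · exact ⟨_, _, isGraft_node_zero c⟩
      · exact ⟨_, _, by simpa using isGraft_node_cons (c 0) (Fin.tail c)⟩
    have hA : c 0 ∈ trees ((c 0).numLeaves - 1) :=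
      (Nat.sub_add_cancel (c 0).numLeaves_pos).symm
    have hB : B ∈ trees (B.numLeaves - 1) := (Nat.sub_add_cancel B.numLeaves_pos).symm
    refine ⟨_, ?_, h.labelVertex_root hA⟩
    have hsum : (node k c).numLeaves = _ := h.mem_trees hA hB
    have hT' : (node k c).numLeaves = n + 1 := hT
    omega

/-! ### Cartesian trees -/

section Cartesian

variable {n : ℕ} {γ : Type*} [LinearOrder γ]

/-- `g`, a function on the labels of `T`, increases weakly towards the root. -/
def IsAdapted (T : PlaneTree) (g : Fin n → γ) : Prop := ∀ i j : Fin n, T.labelLE i j → g i ≤ g j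

/-- `T` is the Cartesian tree of the sequence `g`, with maxima on top: the vertex labeled `j` is
above the one labeled `i` exactly if `g j` is maximal among the entries between `i` and `j`. Equal
entries without a larger one between them label the same vertex. -/
def IsCartesianTree (T : PlaneTree) (g : Fin n → γ) : Prop :=
  ∀ i j : Fin n, T.labelLE i j ↔ ∀ k ∈ Set.uIcc i j, g k ≤ g j

variable {T : PlaneTree}

theorem IsCartesianTree.isAdapted {g : Fin n → γ} (h : T.IsCartesianTree g) : T.IsAdapted g :=
  fun i j hij => (h i j).1 hij i Set.left_mem_uIcc

theorem IsAdapted.le_of_mem_uIcc {g : Fin n → γ} (h : T.IsAdapted g) (hT : T ∈ trees n)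
    {i j k : Fin n} (hij : T.labelLE i j) (hk : k ∈ Set.uIcc i j) : g k ≤ g j :=
  h k j (labelLE_of_mem_uIcc hT hij hk)

theorem IsCartesianTree.labelVertex_eq_nil_iff {g : Fin n → γ} (h : T.IsCartesianTree g)
    (hT : T ∈ trees n) (j : Fin n) : T.labelVertex j = [] ↔ ∀ k, g k ≤ g j := by
  refine ⟨fun hj k => h.isAdapted k j (labelLE_of_labelVertex_eq_nil hj k), fun hj => ?_⟩
  obtain ⟨m, hm, hroot⟩ := exists_labelVertex_eq_nil hT j.pos
  have hmj : T.labelLE m j := (h ⟨m, hm⟩ j).2 fun k _ => hj k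
  rwa [labelLE, hroot, List.prefix_nil] at hmj

@[elab_as_elim]
theorem graft_label_cases {a b : ℕ} {motive : Fin (a + 1 + b) → Prop}
    (left : ∀ i : Fin a, motive (i.castSucc.castAdd b)) (root : motive ((Fin.last a).castAdd b))
    (right : ∀ i : Fin b, motive (i.natAdd (a + 1))) (i : Fin (a + 1 + b)) : motive i :=
  Fin.addCases (Fin.lastCases root left) right i

theorem IsGraft.isCartesianTree {φ : List ℕ → List ℕ} {A B : PlaneTree} {a b : ℕ}
    (h : IsGraft φ A B T) (hA : A ∈ trees a) (hB : B ∈ trees b) {g : Fin (a + 1 + b) → γ}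
    (hroot : ∀ j : Fin (a + 1 + b), T.labelVertex j = [] ↔ ∀ k, g k ≤ g j)
    (hgA : A.IsCartesianTree fun i => g (i.castSucc.castAdd b))
    (hgB : B.IsCartesianTree fun i => g (i.natAdd (a + 1))) : T.IsCartesianTree g := by
  intro i j
  by_cases hj : T.labelVertex j = []
  · exact iff_of_true (labelLE_of_labelVertex_eq_nil hj i) fun k _ => (hroot j).1 hj k
  have hmax : ∀ k, g k ≤ g ((Fin.last a).castAdd b) :=
    (hroot _).1 (by simpa using h.labelVertex_root hA)
  have separated (hmem : (Fin.last a).castAdd b ∈ Set.uIcc i j) :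
      T.labelLE i j ↔ ∀ k ∈ Set.uIcc i j, g k ≤ g j := by
    refine iff_of_false (fun hij => hj ?_) fun hij =>
      hj ((hroot j).2 fun k => (hmax k).trans (hij _ hmem))
    have hle := labelLE_of_mem_uIcc (h.mem_trees hA hB) hij hmem
    rwa [labelLE, Fin.val_castAdd, Fin.val_last, h.labelVertex_root hA, List.prefix_nil] at hle
  induction i using graft_label_cases with
  | root => exact separated Set.left_mem_uIcc
  | left i =>
    induction j using graft_label_cases with
    | root => exact separated Set.right_mem_uIcc
    | left j =>
      rw [← Fin.image_castAdd_uIcc, ← Fin.image_castSucc_uIcc, Set.forall_mem_image,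
        Set.forall_mem_image]
      exact (h.labelLE_left_iff hA i.2 j.2).trans (hgA i j)
    | right j =>
      refine separated (Set.mem_uIcc_of_le (Fin.le_def.2 ?_) (Fin.le_def.2 ?_)) <;>
        simp only [Fin.val_castAdd, Fin.val_castSucc, Fin.val_last, Fin.val_natAdd] <;> omega
  | right i =>
    induction j using graft_label_cases with
    | root => exact separated Set.right_mem_uIcc
    | left j =>
      refine separated (Set.mem_uIcc_of_ge (Fin.le_def.2 ?_) (Fin.le_def.2 ?_)) <;>
        simp only [Fin.val_castAdd, Fin.val_castSucc, Fin.val_last, Fin.val_natAdd] <;> omega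
    | right j =>
      rw [← Fin.image_natAdd_uIcc, Set.forall_mem_image]
      exact (h.labelLE_right_iff hA hB i.2 j.2).trans (hgB i j)

theorem isCartesianTree_node_zero {c : Fin 2 → PlaneTree} {a b : ℕ} (hA : c 0 ∈ trees a)
    (hB : c 1 ∈ trees b) {g : Fin (a + 1 + b) → γ}
    (hmax : ∀ i, i ≠ (Fin.last a).castAdd b → g i < g ((Fin.last a).castAdd b))
    (hgA : (c 0).IsCartesianTree fun i => g (i.castSucc.castAdd b))
    (hgB : (c 1).IsCartesianTree fun i => g (i.natAdd (a + 1))) :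
    (node 0 c).IsCartesianTree g := by
  have h := isGraft_node_zero c
  refine h.isCartesianTree hA hB (fun j => ?_) hgA hgB
  have hargmax : (∀ k, g k ≤ g j) ↔ j = (Fin.last a).castAdd b := by
    refine ⟨fun hj => by_contra fun hne => (hmax j hne).not_ge (hj _), ?_⟩
    rintro rfl k
    rcases eq_or_ne k ((Fin.last a).castAdd b) with rfl | hne
    exacts [le_rfl, (hmax k hne).le]
  rw [hargmax]
  induction j using graft_label_cases with
  | left j => simp [h.labelVertex_left hA j.2, Fin.ext_iff, j.2.ne]
  | root => simp [h.labelVertex_root hA]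
  | right j =>
    have hne : a + 1 + (j : ℕ) ≠ a := by omega
    simp [h.labelVertex_right hA hB j.2, Fin.ext_iff, hne]

theorem isCartesianTree_node_cons {A : PlaneTree} {k : ℕ} {c : Fin (k + 2) → PlaneTree} {a b : ℕ}
    (hA : A ∈ trees a) (hB : node k c ∈ trees b) {g : Fin (a + 1 + b) → γ}
    (hmax : ∀ i, g i ≤ g ((Fin.last a).castAdd b))
    (hlt : ∀ i : Fin a, g (i.castSucc.castAdd b) < g ((Fin.last a).castAdd b)) {m : Fin b}
    (hm : g ((Fin.last a).castAdd b) ≤ g (m.natAdd (a + 1)))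
    (hgA : A.IsCartesianTree fun i => g (i.castSucc.castAdd b))
    (hgB : (node k c).IsCartesianTree fun i => g (i.natAdd (a + 1))) :
    (node (k + 1) (Fin.cons A c : Fin (k + 3) → PlaneTree)).IsCartesianTree g := by
  have h := isGraft_node_cons A c
  refine h.isCartesianTree hA hB (fun j => ?_) hgA hgB
  induction j using graft_label_cases with
  | left j =>
    have hj : ¬∀ i, g i ≤ g (j.castSucc.castAdd b) := fun hj => (hlt j).not_ge (hj _)
    simp [h.labelVertex_left hA j.2, hj]
  | root => simpa [h.labelVertex_root hA] using hmax
  | right j =>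
    rw [Fin.val_natAdd, h.labelVertex_right hA hB j.2, bump_eq_nil,
      hgB.labelVertex_eq_nil_iff hB]
    exact ⟨fun hj i => (hmax i).trans (hm.trans (hj m)), fun hj i => hj _⟩

theorem exists_first_argmax (hn : 0 < n) (g : Fin n → γ) :
    ∃ p, (∀ i, g i ≤ g p) ∧ ∀ i < p, g i < g p := by
  have : NeZero n := ⟨hn.ne'⟩
  obtain ⟨p, hp⟩ := Finite.exists_max fun i : Fin n => toLex (g i, OrderDual.toDual i)
  simp only [Prod.Lex.toLex_le_toLex, OrderDual.toDual_le_toDual] at hp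
  exact ⟨p, fun i => (hp i).elim le_of_lt fun h => h.1.le,
    fun i hi => (hp i).resolve_right fun h => hi.not_ge h.2⟩

theorem exists_isCartesianTree (g : Fin n → γ) : ∃ T ∈ trees n, T.IsCartesianTree g := by
  induction n using Nat.strong_induction_on with
  | _ n ih =>
  rcases n.eq_zero_or_pos with rfl | hn
  · exact ⟨leaf, rfl, fun i => i.elim0⟩
  obtain ⟨⟨a, ha⟩, hmax, hlt⟩ := exists_first_argmax hn g
  obtain ⟨b, rfl⟩ := Nat.exists_eq_add_of_le (Nat.succ_le_of_lt ha)
  obtain ⟨A, hA, hgA⟩ := ih a (by omega) fun i => g (i.castSucc.castAdd b)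
  obtain ⟨B, hB, hgB⟩ := ih b (by omega) fun i => g (i.natAdd (a + 1))
  have hltA (i : Fin a) : g (i.castSucc.castAdd b) < g ((Fin.last a).castAdd b) :=
    hlt _ (Fin.lt_def.2 i.2)
  by_cases hm : ∃ m : Fin b, g ((Fin.last a).castAdd b) ≤ g (m.natAdd (a + 1))
  · obtain ⟨m, hm⟩ := hm
    cases B with
    | leaf => exact absurd (Nat.succ_injective hB) (Nat.ne_of_lt m.pos)
    | node k c =>
      exact ⟨_, (isGraft_node_cons A c).mem_trees hA hB,
        isCartesianTree_node_cons hA hB hmax hltA hm hgA hgB⟩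
  · push Not at hm
    refine ⟨node 0 ![A, B], (isGraft_node_zero ![A, B]).mem_trees hA hB,
      isCartesianTree_node_zero hA hB (fun i hi => ?_) hgA hgB⟩
    induction i using graft_label_cases with
    | left i => exact hltA i
    | root => exact absurd rfl hi
    | right i => exact hm i

end Cartesian

/-! ### Binary trees -/

theorem node_zero_mem_treesInternal {c : Fin 2 → PlaneTree} {a b : ℕ}
    (hA : c 0 ∈ treesInternal a a) (hB : c 1 ∈ treesInternal b b) :
    node 0 c ∈ treesInternal (a + 1 + b) (a + 1 + b) := by
  refine ⟨(isGraft_node_zero c).mem_trees hA.1 hB.1, ?_⟩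
  have hsum : ∑ j, (c j).numInternal = a + b := by
    rw [Fin.sum_univ_two (fun j => (c j).numInternal), hA.2, hB.2]
  rw [numInternal, hsum]
  omega

theorem eq_zero_and_forall_mem_treesInternal {n k : ℕ} {c : Fin (k + 2) → PlaneTree}
    (h : node k c ∈ treesInternal n n) :
    k = 0 ∧ ∀ j, c j ∈ treesInternal (c j).numInternal (c j).numInternal := by
  obtain ⟨hleaves, hinternal⟩ := h
  simp only [trees, Set.mem_ofPred_eq, numLeaves, numInternal] at hleaves hinternal
  have hle : ∀ j ∈ Finset.univ, (c j).numInternal + 1 ≤ (c j).numLeaves :=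
    fun j _ => (c j).numInternal_lt_numLeaves
  have hsum : ∑ j, ((c j).numInternal + 1) = ∑ j, (c j).numInternal + (k + 2) := by
    simp [Finset.sum_add_distrib]
  have hsum_le := Finset.sum_le_sum hle
  have hk : k = 0 := by omega
  have heq := (Finset.sum_eq_sum_iff_of_le hle).1 (by omega)
  exact ⟨hk, fun j => ⟨(heq j (Finset.mem_univ j)).symm, rfl⟩⟩

@[elab_as_elim]
theorem binary_induction {motive : ∀ {n : ℕ} {T : PlaneTree}, T ∈ treesInternal n n → Prop}
    (leaf : motive (n := 0) (T := leaf) ⟨rfl, rfl⟩)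
    (node : ∀ {a b : ℕ} {c : Fin 2 → PlaneTree} (hA : c 0 ∈ treesInternal a a)
      (hB : c 1 ∈ treesInternal b b), motive hA → motive hB →
      motive (node_zero_mem_treesInternal hA hB))
    {n : ℕ} {T : PlaneTree} (hT : T ∈ treesInternal n n) : motive hT := by
  induction T generalizing n with
  | leaf =>
    obtain rfl : n = 0 := hT.2.symm
    exact leaf
  | node k c ih =>
    obtain ⟨rfl, hc⟩ := eq_zero_and_forall_mem_treesInternal hT
    obtain rfl : (c 0).numInternal + 1 + (c 1).numInternal = n :=
      (node_zero_mem_treesInternal (hc 0) (hc 1)).2.symm.trans hT.2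
    exact node (hc 0) (hc 1) (ih 0 (hc 0)) (ih 1 (hc 1))

theorem exists_binary_isCartesianTree {n : ℕ} {γ : Type*} [LinearOrder γ] {g : Fin n → γ}
    (hg : Function.Injective g) : ∃ T ∈ treesInternal n n, T.IsCartesianTree g := by
  induction n using Nat.strong_induction_on with
  | _ n ih =>
  rcases n.eq_zero_or_pos with rfl | hn
  · exact ⟨leaf, ⟨rfl, rfl⟩, fun i => i.elim0⟩
  obtain ⟨⟨a, ha⟩, hmax, -⟩ := exists_first_argmax hn g
  obtain ⟨b, rfl⟩ := Nat.exists_eq_add_of_le (Nat.succ_le_of_lt ha)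
  obtain ⟨A, hA, hgA⟩ := ih a (by omega) (g := fun i => g (i.castSucc.castAdd b)) <|
    hg.comp <| (Fin.castAdd_injective _ b).comp (Fin.castSucc_injective a)
  obtain ⟨B, hB, hgB⟩ := ih b (by omega) (g := fun i => g (i.natAdd (a + 1))) <|
    hg.comp (Fin.natAdd_injective b (a + 1))
  exact ⟨node 0 ![A, B], node_zero_mem_treesInternal hA hB,
    isCartesianTree_node_zero hA.1 hB.1 (fun i hi => (hmax i).lt_of_ne (hg.ne hi)) hgA hgB⟩

section Adapted

variable {n : ℕ} {γ : Type*} [LinearOrder γ]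

-- Ties are broken in favour of `j`.
theorem exists_binary_isAdapted_labelLE {g : Fin n → γ} {i j : Fin n}
    (hij : ∀ k ∈ Set.uIcc i j, g k ≤ g j) :
    ∃ T ∈ treesInternal n n, T.IsAdapted g ∧ T.labelLE i j := by
  let tieBreak (k : Fin n) : γ ×ₗ (ℕ ×ₗ Fin n) := toLex (g k, toLex (if k = j then 1 else 0, k))
  have hinj : Function.Injective tieBreak := fun k l h => by
    simp only [tieBreak, EmbeddingLike.apply_eq_iff_eq, Prod.mk.injEq] at h
    exact h.2.2
  obtain ⟨T, hT, hcart⟩ := exists_binary_isCartesianTree hinj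
  refine ⟨T, hT, fun k l hkl => Prod.Lex.monotone_fst _ _ (hcart.isAdapted k l hkl),
    (hcart i j).2 fun k hk => ?_⟩
  refine Prod.Lex.toLex_le_toLex'.2 ⟨hij k hk, fun _ => ?_⟩
  rcases eq_or_ne k j with rfl | hkj
  · exact le_rfl
  · exact Prod.Lex.toLex_le_toLex.2 (Or.inl (by simp [hkj]))

theorem exists_binary_isAdapted (g : Fin n → γ) : ∃ T ∈ treesInternal n n, T.IsAdapted g := by
  have hinj : Function.Injective fun k => toLex (g k, k) := fun k l h => by
    simp only [EmbeddingLike.apply_eq_iff_eq, Prod.mk.injEq] at h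
    exact h.2
  obtain ⟨T, hT, hcart⟩ := exists_binary_isCartesianTree hinj
  exact ⟨T, hT, fun k l hkl => Prod.Lex.monotone_fst _ _ (hcart.isAdapted k l hkl)⟩

end Adapted

section Binary

variable {n : ℕ} {T : PlaneTree}

theorem labelVertex_injective (hT : T ∈ treesInternal n n) :
    Function.Injective fun i : Fin n => T.labelVertex i := by
  induction hT using binary_induction with
  | leaf => exact fun i => i.elim0
  | @node a b c hA hB injA injB =>
    have h := isGraft_node_zero c
    have injA' (i j : Fin a) : (c 0).labelVertex i = (c 0).labelVertex j ↔ i = j := injA.eq_iff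
    have injB' (i j : Fin b) : (c 1).labelVertex i = (c 1).labelVertex j ↔ i = j := injB.eq_iff
    intro i j
    induction i using graft_label_cases <;> induction j using graft_label_cases <;>
      simp [h.labelVertex_left hA.1, h.labelVertex_root hA.1, h.labelVertex_right hA.1 hB.1,
        injA', injB']

theorem labelLE_antisymm (hT : T ∈ treesInternal n n) {i j : Fin n} (hij : T.labelLE i j)
    (hji : T.labelLE j i) : i = j :=
  labelVertex_injective hT (hji.eq_of_length_le hij.length_le)

theorem IsCartesianTree.labelLE_iff_of_isAdapted {γ : Type*} [LinearOrder γ] {g : Fin n → γ}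
    {T' : PlaneTree} (h : T.IsCartesianTree g) (hT : T ∈ treesInternal n n) (hT' : T' ∈ trees n)
    (hT'g : T'.IsAdapted g) (i j : Fin n) : T'.labelLE i j ↔ T.labelLE i j := by
  have of_isAdapted {i j : Fin n} (hij : T'.labelLE i j) : T.labelLE i j :=
    (h i j).2 fun _ hk => hT'g.le_of_mem_uIcc hT' hij hk
  refine ⟨of_isAdapted, fun hij => ?_⟩
  obtain ⟨t, ht, htop⟩ := exists_forall_labelLE hT' i j
  obtain rfl : j = t := labelLE_antisymm hT (of_isAdapted (htop j Set.right_mem_uIcc))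
    (labelLE_of_mem_uIcc hT.1 hij ht)
  exact htop i Set.left_mem_uIcc

theorem labelLE_node_zero_left_iff {a b k i : ℕ} {c : Fin 2 → PlaneTree} (hA : c 0 ∈ trees a)
    (hB : c 1 ∈ trees b) (hk : k < a + 1 + b) (hi : i < a) :
    (node 0 c).labelLE k i ↔ k < a ∧ (c 0).labelLE k i := by
  have h := isGraft_node_zero c
  rcases lt_trichotomy k a with hka | rfl | hak
  · rw [h.labelLE_left_iff hA hka hi, and_iff_right hka]
  · simp [labelLE, h.labelVertex_left hA hi, h.labelVertex_root hA]
  · obtain ⟨k, rfl⟩ := Nat.exists_eq_add_of_le (Nat.succ_le_of_lt hak)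
    have hkb : k < b := by omega
    simp [labelLE, h.labelVertex_left hA hi, h.labelVertex_right hA hB hkb, hak.not_gt]

theorem labelLE_node_zero_right_iff {a b k i : ℕ} {c : Fin 2 → PlaneTree} (hA : c 0 ∈ trees a)
    (hB : c 1 ∈ trees b) (hk : k < a + 1 + b) (hi : i < b) :
    (node 0 c).labelLE k (a + 1 + i) ↔ a < k ∧ (c 1).labelLE (k - (a + 1)) i := by
  have h := isGraft_node_zero c
  rcases lt_trichotomy k a with hka | rfl | hak
  · simp [labelLE, h.labelVertex_left hA hka, h.labelVertex_right hA hB hi, hka.not_gt]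
  · simp [labelLE, h.labelVertex_root hA, h.labelVertex_right hA hB hi]
  · obtain ⟨k, rfl⟩ := Nat.exists_eq_add_of_le (Nat.succ_le_of_lt hak)
    rw [h.labelLE_right_iff hA hB (by omega) hi, and_iff_right hak, Nat.add_sub_cancel_left]

theorem exists_subtreeAt_labelVertex_eq (hT : T ∈ treesInternal n n) (i : Fin n) :
    ∃ c : Fin 2 → PlaneTree, T.subtreeAt (T.labelVertex i) = node 0 c ∧
      (c 0).numInternal ≤ i ∧ i + (c 1).numInternal < n ∧
      ∀ k : Fin n, T.labelLE k i ↔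
        (i : ℕ) ≤ k + (c 0).numInternal ∧ (k : ℕ) ≤ i + (c 1).numInternal := by
  induction hT using binary_induction with
  | leaf => exact i.elim0
  | @node a b c hA hB ihA ihB =>
    have h := isGraft_node_zero c
    induction i using graft_label_cases with
    | left i =>
      obtain ⟨e, hsub, hle, hlt, hiff⟩ := ihA i
      simp only [Fin.forall_iff] at hiff
      simp only [Fin.val_castAdd, Fin.val_castSucc]
      refine ⟨e, by simp [h.labelVertex_left hA.1, subtreeAt, hsub], hle, by omega,
        fun k => ?_⟩
      rw [labelLE_node_zero_left_iff hA.1 hB.1 k.2 i.2, and_congr_right (hiff k)]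
      omega
    | root =>
      simp only [Fin.val_castAdd, Fin.val_last]
      refine ⟨c, by simp [h.labelVertex_root hA.1, subtreeAt], hA.2.le, by rw [hB.2]; omega,
        fun k => ?_⟩
      rw [hA.2, hB.2]
      exact iff_of_true (labelLE_of_labelVertex_eq_nil (h.labelVertex_root hA.1) k) (by omega)
    | right i =>
      obtain ⟨e, hsub, hle, hlt, hiff⟩ := ihB i
      simp only [Fin.forall_iff] at hiff
      simp only [Fin.val_natAdd]
      refine ⟨e, by simp [h.labelVertex_right hA.1 hB.1, subtreeAt, hsub], by omega, by omega,
        fun k => ?_⟩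
      rw [labelLE_node_zero_right_iff hA.1 hB.1 k.2 i.2,
        and_congr_right fun hak => hiff (k - (a + 1)) (by omega)]
      omega

end Binary

end PlaneTree

/-! ### The Loday coefficients of a binary tree -/

section Loday

open Finset PlaneTree

/-- The second differences `B (k + 1) - 2 * B k + B (k - 1)` of a sequence `B` that starts with
`B 0 = 0` and is extended by zero to the left. -/
def secondDiff (B : ℕ → ℝ) : ℕ → ℝ
  | 0 => B 1
  | k + 1 => B (k + 2) - 2 * B (k + 1) + B k

theorem sum_range_secondDiff_add_succ (B : ℕ → ℝ) (l m : ℕ) :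
    ∑ y ∈ range m, secondDiff B (l + 1 + y) =
      B (l + 1 + m) - B (l + m) - (B (l + 1) - B l) := by
  induction m with
  | zero => simp
  | succ m ih =>
    rw [sum_range_succ, ih, add_right_comm l 1 m, secondDiff, add_right_comm l 1 (m + 1),
      ← add_assoc l m 1]
    ring

theorem sum_range_secondDiff {B : ℕ → ℝ} (hB : B 0 = 0) (m : ℕ) :
    ∑ y ∈ range (m + 1), secondDiff B y = B (m + 1) - B m := by
  induction m with
  | zero => simp [secondDiff, hB]
  | succ m ih =>
    rw [sum_range_succ, ih, secondDiff]
    ring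

theorem sum_sum_range_secondDiff {B : ℕ → ℝ} (hB : B 0 = 0) (l r : ℕ) :
    ∑ x ∈ range (l + 1), ∑ y ∈ range (r + 1), secondDiff B (x + y) =
      B (l + r + 1) - B l - B r := by
  induction l with
  | zero => simp [sum_range_secondDiff hB, hB]
  | succ l ih =>
    rw [sum_range_succ, ih, sum_range_secondDiff_add_succ, show l + 1 + (r + 1) = l + 1 + r + 1 by
      omega, show l + (r + 1) = l + r + 1 by omega]
    ring

variable {n : ℕ} {β : Fin n → ℝ}

@[simp] theorem prefixSum_zero (β : Fin n → ℝ) : prefixSum β 0 = 0 := by simp [prefixSum]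

theorem prefixSum_succ (β : Fin n → ℝ) (i : Fin n) :
    prefixSum β (i + 1) = prefixSum β i + β i := by
  have hset : ({k | (k : ℕ) < i + 1} : Finset (Fin n)) =
      insert i ({k | (k : ℕ) < i} : Finset (Fin n)) := by
    ext k
    simp only [mem_filter_univ, mem_insert, Fin.ext_iff]
    omega
  rw [prefixSum, hset, sum_insert (by simp), add_comm, prefixSum]

theorem secondDiff_prefixSum_pos (hβ : StrictMono β) {k : ℕ} (hk : 0 < k) (hkn : k < n) :
    0 < secondDiff (prefixSum β) k := by
  obtain ⟨k, rfl⟩ := Nat.exists_eq_succ_of_ne_zero hk.ne'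
  have hlt : β ⟨k, by omega⟩ < β ⟨k + 1, hkn⟩ := hβ (Fin.mk_lt_mk.2 k.lt_succ_self)
  have h₁ := prefixSum_succ β ⟨k, by omega⟩
  have h₂ := prefixSum_succ β ⟨k + 1, hkn⟩
  simp only [secondDiff] at h₁ h₂ ⊢
  linarith

variable {T T' : PlaneTree}

open Classical in
theorem treeCoeff_eq_sum (β : Fin n → ℝ) (hT : T ∈ treesInternal n n) (i : Fin n) :
    treeCoeff β T i = ∑ pq : Fin n × Fin n with
      (pq.1 ≤ i ∧ i ≤ pq.2) ∧ T.labelLE pq.1 i ∧ T.labelLE pq.2 i,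
        secondDiff (prefixSum β) (pq.2 - pq.1) := by
  obtain ⟨c, hsub, hl, hr, hiff⟩ := exists_subtreeAt_labelVertex_eq hT i
  have hval : treeCoeff β T i = prefixSum β ((c 0).numInternal + (c 1).numInternal + 1) -
      prefixSum β (c 0).numInternal - prefixSum β (c 1).numInternal := by
    rw [treeCoeff, hsub, treeVal, numInternal, Fin.sum_univ_two (fun j => (c j).numInternal),
      Fin.sum_univ_two (fun j => prefixSum β (c j).numInternal), add_comm 1, sub_sub]
  rw [hval, ← sum_sum_range_secondDiff (prefixSum_zero β), ← sum_product']
  symm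
  refine sum_nbij (fun pq => (i - pq.1, pq.2 - i)) ?_ ?_ ?_ ?_
  · rintro ⟨p, q⟩ hpq
    simp only [mem_filter_univ, hiff, mem_product, mem_range] at hpq ⊢
    omega
  · rintro ⟨p, q⟩ hpq ⟨p', q'⟩ hpq' h
    simp only [coe_filter_univ, Set.mem_ofPred_eq, Fin.le_def, Prod.mk.injEq, Fin.ext_iff]
      at hpq hpq' h ⊢
    omega
  · rintro ⟨x, y⟩ hxy
    simp only [coe_product, coe_range, Set.mem_prod, Set.mem_Iio] at hxy
    refine ⟨(⟨i - x, by omega⟩, ⟨i + y, by omega⟩), ?_, ?_⟩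
    · simp only [coe_filter_univ, Set.mem_ofPred_eq, Fin.le_def, hiff]
      omega
    · simp only [Prod.mk.injEq]
      omega
  · rintro ⟨p, q⟩ hpq
    obtain ⟨⟨hp : p ≤ i, hq : i ≤ q⟩, -⟩ := (mem_filter.1 hpq).2
    rw [show (q : ℕ) - p = i - p + (q - i) by omega]

theorem finite_image_treeCoeff (β : Fin n → ℝ) : (treeCoeff β '' treesInternal n n).Finite := by
  classical
  refine (Set.finite_range fun (r : Fin n → Fin n → Prop) i => ∑ pq : Fin n × Fin n with
    (pq.1 ≤ i ∧ i ≤ pq.2) ∧ r pq.1 i ∧ r pq.2 i,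
      secondDiff (prefixSum β) (pq.2 - pq.1)).subset ?_
  rintro _ ⟨T, hT, rfl⟩
  exact ⟨fun i j => T.labelLE i j, funext fun i => (treeCoeff_eq_sum β hT i).symm⟩

theorem treeCoeff_congr (β : Fin n → ℝ) (hT : T ∈ treesInternal n n) (hT' : T' ∈ treesInternal n n)
    (h : ∀ i j : Fin n, T.labelLE i j ↔ T'.labelLE i j) : treeCoeff β T = treeCoeff β T' := by
  classical
  funext i
  simp only [treeCoeff_eq_sum β hT, treeCoeff_eq_sum β hT', h]

/-- The label in the interval between `p` and `q` whose vertex is closest to the root. -/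
noncomputable def intervalTop (hT : T ∈ trees n) (p q : Fin n) : Fin n :=
  (exists_forall_labelLE hT p q).choose

theorem intervalTop_mem_uIcc (hT : T ∈ trees n) (p q : Fin n) :
    intervalTop hT p q ∈ Set.uIcc p q :=
  (exists_forall_labelLE hT p q).choose_spec.1

theorem labelLE_intervalTop (hT : T ∈ trees n) {p q k : Fin n} (hk : k ∈ Set.uIcc p q) :
    T.labelLE k (intervalTop hT p q) :=
  (exists_forall_labelLE hT p q).choose_spec.2 k hk

theorem intervalTop_eq_iff (hT : T ∈ treesInternal n n) {p q i : Fin n} (hpq : p ≤ q) :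
    intervalTop hT.1 p q = i ↔ (p ≤ i ∧ i ≤ q) ∧ T.labelLE p i ∧ T.labelLE q i := by
  have hmem := intervalTop_mem_uIcc hT.1 p q
  rw [Set.uIcc_of_le hpq] at hmem
  constructor
  · rintro rfl
    exact ⟨hmem, labelLE_intervalTop _ Set.left_mem_uIcc, labelLE_intervalTop _ Set.right_mem_uIcc⟩
  · rintro ⟨hi, hp, hq⟩
    refine labelLE_antisymm hT ?_ (labelLE_intervalTop _ (Set.mem_uIcc_of_le hi.1 hi.2))
    rcases le_total (intervalTop hT.1 p q) i with h | h
    · exact labelLE_of_mem_uIcc hT.1 hp (Set.mem_uIcc_of_le hmem.1 h)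
    · exact labelLE_of_mem_uIcc hT.1 hq (Set.mem_uIcc_of_ge h hmem.2)

-- The Loday associahedron is a Minkowski sum of dilated simplices, one for every interval.
theorem sum_treeCoeff_mul (β : Fin n → ℝ) (hT : T ∈ treesInternal n n) (g : Fin n → ℝ) :
    ∑ i, treeCoeff β T i * g i = ∑ pq : Fin n × Fin n with pq.1 ≤ pq.2,
      secondDiff (prefixSum β) (pq.2 - pq.1) * g (intervalTop hT.1 pq.1 pq.2) := by
  classical
  rw [← sum_fiberwise _ fun pq : Fin n × Fin n => intervalTop hT.1 pq.1 pq.2]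
  refine sum_congr rfl fun i _ => ?_
  rw [treeCoeff_eq_sum β hT, sum_mul, filter_filter]
  refine sum_congr (filter_congr fun pq _ => ?_) fun pq hpq => ?_
  · constructor
    · exact fun h => ⟨h.1.1.trans h.1.2, (intervalTop_eq_iff hT (h.1.1.trans h.1.2)).2 h⟩
    · exact fun h => (intervalTop_eq_iff hT h.1).1 h.2
  · rw [(mem_filter.1 hpq).2.2]

theorem secondDiff_mul_intervalTop_le (hβ : StrictMono β) (hT : T ∈ trees n) (hT' : T' ∈ trees n)
    {g : Fin n → ℝ} (h : T.IsAdapted g) {p q : Fin n} (hpq : p ≤ q) :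
    secondDiff (prefixSum β) (q - p) * g (intervalTop hT' p q) ≤
      secondDiff (prefixSum β) (q - p) * g (intervalTop hT p q) := by
  rcases hpq.eq_or_lt with rfl | hlt
  · have htop {S : PlaneTree} (hS : S ∈ trees n) : intervalTop hS p p = p := by
      simpa using intervalTop_mem_uIcc hS p p
    rw [htop hT, htop hT']
  · exact mul_le_mul_of_nonneg_left
      (h _ _ (labelLE_intervalTop hT (intervalTop_mem_uIcc hT' p q)))
      (secondDiff_prefixSum_pos hβ (by omega) (by omega)).le

theorem sum_treeCoeff_mul_le (hβ : StrictMono β) (hT : T ∈ treesInternal n n)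
    (hT' : T' ∈ treesInternal n n) {g : Fin n → ℝ} (h : T.IsAdapted g) :
    ∑ i, treeCoeff β T' i * g i ≤ ∑ i, treeCoeff β T i * g i := by
  rw [sum_treeCoeff_mul β hT, sum_treeCoeff_mul β hT']
  exact sum_le_sum fun pq hpq =>
    secondDiff_mul_intervalTop_le hβ hT.1 hT'.1 h (mem_filter.1 hpq).2

theorem isAdapted_of_sum_treeCoeff_mul_eq (hβ : StrictMono β) (hT : T ∈ treesInternal n n)
    (hT' : T' ∈ treesInternal n n) {g : Fin n → ℝ} (h : T.IsAdapted g)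
    (heq : ∑ i, treeCoeff β T' i * g i = ∑ i, treeCoeff β T i * g i) : T'.IsAdapted g := by
  have htop {p q : Fin n} (hpq : p < q) :
      g (intervalTop hT'.1 p q) = g (intervalTop hT.1 p q) := by
    rw [sum_treeCoeff_mul β hT, sum_treeCoeff_mul β hT'] at heq
    have hterm := (sum_eq_sum_iff_of_le fun pq hpq => secondDiff_mul_intervalTop_le hβ hT.1 hT'.1 h
      (mem_filter.1 hpq).2).1 heq (p, q) (mem_filter.2 ⟨mem_univ _, hpq.le⟩)
    have hpos := secondDiff_prefixSum_pos hβ (k := q - p) (by omega) (by omega)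
    exact mul_left_cancel₀ hpos.ne' hterm
  intro i j hij
  rcases lt_trichotomy i j with hlt | rfl | hlt
  · rw [← (intervalTop_eq_iff hT' hlt.le).2 ⟨⟨hlt.le, le_rfl⟩, hij, labelLE_refl _ _⟩, htop hlt]
    exact h _ _ (labelLE_intervalTop hT.1 Set.left_mem_uIcc)
  · exact le_rfl
  · rw [← (intervalTop_eq_iff hT' hlt.le).2 ⟨⟨le_rfl, hlt.le⟩, labelLE_refl _ _, hij⟩, htop hlt]
    exact h _ _ (labelLE_intervalTop hT.1 Set.right_mem_uIcc)

theorem sum_treeCoeff_mul_eq_iff (hβ : StrictMono β) (hT : T ∈ treesInternal n n)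
    (hT' : T' ∈ treesInternal n n) {g : Fin n → ℝ} (h : T.IsAdapted g) :
    ∑ i, treeCoeff β T' i * g i = ∑ i, treeCoeff β T i * g i ↔ T'.IsAdapted g :=
  ⟨isAdapted_of_sum_treeCoeff_mul_eq hβ hT hT' h, fun h' =>
    (sum_treeCoeff_mul_le hβ hT hT' h).antisymm (sum_treeCoeff_mul_le hβ hT' hT h')⟩

end Loday

/-! ### Ordered partitions -/

/-- The differences of consecutive entries of `u`. -/
def gap {m : ℕ} (u : Fin (m + 1) → ℝ) (i : Fin m) : ℝ := u i.succ - u i.castSucc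

section Gap

variable {m : ℕ} {u : Fin (m + 1) → ℝ}

theorem monotone_iff_gap_nonneg : Monotone u ↔ ∀ i, 0 ≤ gap u i := by
  simp only [Fin.monotone_iff_le_succ, gap, sub_nonneg]

theorem strictMono_iff_gap_pos : StrictMono u ↔ ∀ i, 0 < gap u i := by
  simp only [Fin.strictMono_iff_lt_succ, gap, sub_pos]

theorem gap_partialSum (g : Fin m → ℝ) : gap (Fin.partialSum g) = g :=
  funext fun i => by rw [gap, Fin.partialSum_succ, add_sub_cancel_left]

end Gap

theorem exists_perm_monotone_and_le {n : ℕ} {γ : Type*} [LinearOrder γ] (f : Fin n → γ)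
    {x y : Fin n} (h : f x ≤ f y) :
    ∃ π : Equiv.Perm (Fin n), Monotone (f ∘ π.symm) ∧ π x ≤ π y := by
  let key (z : Fin n) : γ ×ₗ ℕ := toLex (f z, if z = y then 1 else 0)
  have hmono : Monotone (key ∘ Tuple.sort key) := Tuple.monotone_sort key
  refine ⟨(Tuple.sort key).symm, fun i j hij => Prod.Lex.monotone_fst _ _ (hmono hij), ?_⟩
  rcases eq_or_ne x y with rfl | hne
  · exact le_rfl
  refine not_lt.1 fun hlt => ?_
  have hle : key y ≤ key x := by simpa using hmono hlt.le
  simp only [key, Prod.Lex.toLex_le_toLex', if_true, if_neg hne] at hle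
  exact absurd (hle.2 (hle.1.antisymm h)) (by simp)

theorem exists_surjective_strictMono_eq_comp {ι γ : Type*} [Finite ι] [Nonempty ι] [LinearOrder γ]
    (w : ι → γ) : ∃ (m : ℕ) (f : ι → Fin (m + 1)) (u : Fin (m + 1) → γ),
      Function.Surjective f ∧ StrictMono u ∧ w = u ∘ f := by
  have : Fintype (Set.range w) := Fintype.ofFinite _
  obtain ⟨m, hm⟩ := Nat.exists_eq_succ_of_ne_zero (Fintype.card_ne_zero (α := Set.range w))
  let e := Fintype.orderIsoFinOfCardEq (Set.range w) hm
  refine ⟨m, e.symm ∘ Set.rangeFactorization w, Subtype.val ∘ e,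
    e.symm.surjective.comp Set.rangeFactorization_surjective, fun a b hab => e.strictMono hab,
    funext fun i => by simp⟩

theorem exists_monotone_eq_comp {ι γ κ : Type*} [PartialOrder γ] [Preorder κ] {f : ι → κ}
    (hf : Function.Surjective f) {w : ι → γ} (h : ∀ x y, f x ≤ f y → w x ≤ w y) :
    ∃ u : κ → γ, Monotone u ∧ w = u ∘ f := by
  obtain ⟨r, hr⟩ := hf.hasRightInverse
  refine ⟨w ∘ r, fun a b hab => h _ _ (by rwa [hr a, hr b]), funext fun x => ?_⟩
  exact (h _ _ (hr (f x)).ge).antisymm (h _ _ (hr (f x)).le)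

namespace OrderedPartition

section BlockIndex

variable {n k : ℕ}

/-- The index of the block that contains a given element. -/
noncomputable def blockIndex (S : OrderedPartition n k) (x : Fin n) : Fin k := (S.cover x).choose

variable (S : OrderedPartition n k)

theorem mem_block_iff {x : Fin n} {a : Fin k} : x ∈ S.block a ↔ S.blockIndex x = a := by
  have hx : x ∈ S.block (S.blockIndex x) := (S.cover x).choose_spec
  refine ⟨fun ha => by_contra fun hne => ?_, fun h => h ▸ hx⟩
  exact Finset.disjoint_left.1 (S.disjoint _ _ hne) hx ha

theorem blockIndex_surjective : Function.Surjective S.blockIndex := fun a =>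
  (S.nonempty a).imp fun _ => S.mem_block_iff.1

theorem permPartition_refines_iff {π : Equiv.Perm (Fin n)} :
    (permPartition π).Refines S ↔ Monotone (S.blockIndex ∘ π.symm) := by
  have hblock (a : Fin n) (b : Fin k) :
      (permPartition π).block a ⊆ S.block b ↔ S.blockIndex (π.symm a) = b := by
    rw [← mem_block_iff]
    exact Finset.singleton_subset_iff
  simp only [Refines, hblock]
  refine ⟨?_, fun h => ⟨_, h, fun _ => rfl⟩⟩
  rintro ⟨f, hf, h⟩
  exact (funext h : S.blockIndex ∘ π.symm = f) ▸ hf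

theorem blockIndex_permPartition (π : Equiv.Perm (Fin n)) : (permPartition π).blockIndex = π :=
  funext fun x => (mem_block_iff _).1 <| Finset.mem_singleton.2 (π.symm_apply_apply x).symm

/-- The ordered partition into the fibers of `f`. -/
def ofSurjective (f : Fin n → Fin k) (hf : Function.Surjective f) : OrderedPartition n k where
  block a := {x | f x = a}
  nonempty a := (hf a).imp fun _ hx => Finset.mem_filter.2 ⟨Finset.mem_univ _, hx⟩
  disjoint _ _ hab := Finset.disjoint_filter.2 fun _ _ ha hb => hab (ha.symm.trans hb)
  cover x := ⟨f x, Finset.mem_filter.2 ⟨Finset.mem_univ _, rfl⟩⟩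

theorem blockIndex_ofSurjective {f : Fin n → Fin k} (hf : Function.Surjective f) :
    (ofSurjective f hf).blockIndex = f :=
  funext fun _ => (mem_block_iff _).1 <| Finset.mem_filter.2 ⟨Finset.mem_univ _, rfl⟩

end BlockIndex

section Cut

variable {d m : ℕ} (S : OrderedPartition (d + 1) (m + 1)) {π : Equiv.Perm (Fin (d + 1))}

theorem typeEntry_eq_card (a : Fin m) :
    S.typeEntry a = Finset.card {x | S.blockIndex x ≤ a.castSucc} := by
  rw [typeEntry, ← Finset.card_biUnion fun b _ c _ hbc => S.disjoint b c hbc]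
  congr 1
  ext x
  simp [mem_block_iff, Fin.le_def]

variable {S}

theorem lt_typeEntry_iff (hπ : Monotone (S.blockIndex ∘ π.symm)) (a : Fin m) (i : Fin (d + 1)) :
    i < S.typeEntry a ↔ S.blockIndex (π.symm i) ≤ a.castSucc := by
  have hcard : S.typeEntry a =
      Finset.card {i | (S.blockIndex ∘ π.symm) i ≤ a.castSucc} := by
    rw [typeEntry_eq_card]
    exact Finset.card_equiv π (by simp)
  rw [hcard]
  exact Tuple.lt_card_le_iff_apply_le_of_monotone hπ

theorem exists_typeEntry_eq (S : OrderedPartition (d + 1) (m + 1)) (a : Fin m) :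
    ∃ i : Fin d, S.typeEntry a = i + 1 := by
  let π := (Tuple.sort S.blockIndex).symm
  have hπ : Monotone (S.blockIndex ∘ π.symm) := Tuple.monotone_sort S.blockIndex
  obtain ⟨x, hx⟩ := S.blockIndex_surjective a.castSucc
  obtain ⟨y, hy⟩ := S.blockIndex_surjective a.succ
  have hlt := (lt_typeEntry_iff hπ a (π x)).2 (by simp [hx])
  have hge := (lt_typeEntry_iff hπ a (π y)).not.2 (by simp [hy])
  exact ⟨⟨S.typeEntry a - 1, by omega⟩, by dsimp only; omega⟩

/-- The entry `t_{a+1}` of the type of `S` as a label in `{1, …, d}`, hence shifted by one: when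
`[d + 1]` is sorted by blocks, the block `a` ends at the position `cut S a`. -/
noncomputable def cut (S : OrderedPartition (d + 1) (m + 1)) (a : Fin m) : Fin d :=
  (S.exists_typeEntry_eq a).choose

theorem typeEntry_eq_iff {a : Fin m} {i : Fin d} : S.typeEntry a = i + 1 ↔ S.cut a = i := by
  rw [(S.exists_typeEntry_eq a).choose_spec, Nat.add_right_cancel_iff, Fin.val_inj, cut]

theorem blockIndex_castSucc_le_iff (hπ : Monotone (S.blockIndex ∘ π.symm)) {a : Fin m}
    {i : Fin d} : S.blockIndex (π.symm i.castSucc) ≤ a.castSucc ↔ i ≤ S.cut a := by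
  rw [← lt_typeEntry_iff hπ, typeEntry_eq_iff.2 rfl, Fin.val_castSucc, Nat.lt_succ_iff, Fin.le_def]

theorem blockIndex_succ_le_iff (hπ : Monotone (S.blockIndex ∘ π.symm)) {a : Fin m}
    {i : Fin d} : S.blockIndex (π.symm i.succ) ≤ a.castSucc ↔ i < S.cut a := by
  rw [← lt_typeEntry_iff hπ, typeEntry_eq_iff.2 rfl, Fin.val_succ, Nat.succ_lt_succ_iff, Fin.lt_def]

theorem blockIndex_castSucc_cut (hπ : Monotone (S.blockIndex ∘ π.symm)) (a : Fin m) :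
    S.blockIndex (π.symm (S.cut a).castSucc) = a.castSucc := by
  obtain ⟨x, hx⟩ := S.blockIndex_surjective a.castSucc
  have hlt := (lt_typeEntry_iff hπ a (π x)).2 (by simp [hx])
  rw [typeEntry_eq_iff.2 rfl, Nat.lt_succ_iff] at hlt
  refine ((blockIndex_castSucc_le_iff hπ).2 le_rfl).antisymm ?_
  simpa [hx] using hπ (Fin.le_def.2 hlt : π x ≤ (S.cut a).castSucc)

theorem blockIndex_succ_cut (hπ : Monotone (S.blockIndex ∘ π.symm)) (a : Fin m) :
    S.blockIndex (π.symm (S.cut a).succ) = a.succ := by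
  obtain ⟨y, hy⟩ := S.blockIndex_surjective a.succ
  have hge := (lt_typeEntry_iff hπ a (π y)).not.2 (by simp [hy])
  rw [typeEntry_eq_iff.2 rfl, not_lt] at hge
  refine le_antisymm ?_ (Fin.castSucc_lt_iff_succ_le.1 <|
    not_le.1 ((blockIndex_succ_le_iff hπ).not.2 (lt_irrefl _)))
  simpa [hy] using hπ (Fin.le_def.2 hge : (S.cut a).succ ≤ π y)

theorem cut_strictMono (S : OrderedPartition (d + 1) (m + 1)) : StrictMono S.cut := by
  intro a b hab
  have hπ : Monotone (S.blockIndex ∘ (Tuple.sort S.blockIndex).symm.symm) :=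
    Tuple.monotone_sort S.blockIndex
  rw [← blockIndex_succ_le_iff hπ, blockIndex_succ_cut hπ]
  exact Fin.succ_le_castSucc_iff.2 hab

theorem blockIndex_succ_eq_of_notMem_range_cut (hπ : Monotone (S.blockIndex ∘ π.symm)) {i : Fin d}
    (hi : i ∉ Set.range S.cut) :
    S.blockIndex (π.symm i.succ) = S.blockIndex (π.symm i.castSucc) := by
  refine le_antisymm (not_lt.1 fun hlt => hi ?_) (hπ (Fin.castSucc_le_succ i))
  obtain ⟨a, ha⟩ := Fin.exists_castSucc_eq.2 (Fin.ne_last_of_lt hlt)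
  rw [← ha] at hlt
  exact ⟨a, le_antisymm (not_lt.1 ((blockIndex_succ_le_iff hπ).not.1 hlt.not_ge))
    ((blockIndex_castSucc_le_iff hπ).1 ha.ge)⟩

variable {u : Fin (m + 1) → ℝ}

theorem gap_comp_symm_cut (hπ : Monotone (S.blockIndex ∘ π.symm)) (a : Fin m) :
    gap ((u ∘ S.blockIndex) ∘ π.symm) (S.cut a) = gap u a := by
  simp only [gap, Function.comp_apply, blockIndex_castSucc_cut hπ, blockIndex_succ_cut hπ]

theorem gap_comp_symm_eq_zero (hπ : Monotone (S.blockIndex ∘ π.symm)) {i : Fin d}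
    (hi : i ∉ Set.range S.cut) : gap ((u ∘ S.blockIndex) ∘ π.symm) i = 0 := by
  simp only [gap, Function.comp_apply, blockIndex_succ_eq_of_notMem_range_cut hπ hi, sub_self]

end Cut

end OrderedPartition

/-! ### The cones `σ(𝒮,T)` -/

namespace PlaneTree

theorem exists_minimal_labelLE {n : ℕ} (T : PlaneTree) (a : Fin n) :
    ∃ m : Fin n, T.labelLE m a ∧ ∀ k : Fin n, T.labelLE k m → T.labelLE m k := by
  obtain ⟨m, hma, hm⟩ := Set.exists_max_image {m : Fin n | T.labelLE m a}
    (fun m => (T.labelVertex m).length) (Set.toFinite _) ⟨a, T.labelLE_refl a⟩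
  refine ⟨m, hma, fun k hkm => ?_⟩
  rw [labelLE, hkm.eq_of_length_le (hm k (hkm.trans hma))]

theorem isCartesianTree_of_strictAnti {n : ℕ} {γ : Type*} [LinearOrder γ] {T : PlaneTree}
    (hT : T ∈ trees n) {f : ℕ → γ} (hf : StrictAnti f) :
    T.IsCartesianTree fun i : Fin n => f (T.labelVertex i).length := by
  refine fun i j => ⟨fun hij k hk => hf.antitone (labelLE_of_mem_uIcc hT hij hk).length_le,
    fun h => ?_⟩
  obtain ⟨t, ht, htop⟩ := exists_forall_labelLE hT i j
  have hjt : T.labelLE j t := htop j Set.right_mem_uIcc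
  have hit : T.labelLE i t := htop i Set.left_mem_uIcc
  rwa [labelLE, ← hjt.eq_of_length_le (hf.le_iff_ge.1 (h t ht))]

end PlaneTree

theorem coordDiff_mk {d : ℕ} (i j : Fin (d + 1)) (w : Fin (d + 1) → ℝ) :
    coordDiff i j (Submodule.Quotient.mk w) = w j - w i := rfl

theorem D_mk {d : ℕ} (π : Equiv.Perm (Fin (d + 1))) (i : Fin d) (w : Fin (d + 1) → ℝ) :
    D π i (Submodule.Quotient.mk w) = gap (w ∘ π.symm) i := rfl

/-- `w` becomes weakly increasing when its entries are rearranged along `π`, and the gaps of the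
rearrangement increase weakly towards the root of `T`. -/
def SortedAdapted {d : ℕ} (w : Fin (d + 1) → ℝ) (π : Equiv.Perm (Fin (d + 1))) (T : PlaneTree) :
    Prop :=
  Monotone (w ∘ π.symm) ∧ T.IsAdapted (gap (w ∘ π.symm))

theorem exists_sortedAdapted {d : ℕ} (w : Fin (d + 1) → ℝ) :
    ∃ π, ∃ T ∈ treesInternal d d, SortedAdapted w π T :=
  have ⟨T, hT, hTw⟩ := PlaneTree.exists_binary_isAdapted (gap (w ∘ Tuple.sort w))
  ⟨(Tuple.sort w).symm, T, hT, Tuple.monotone_sort w, hTw⟩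

namespace PartitionLabeledTree

variable {d : ℕ} {X : PartitionLabeledTree d} {w w₀ : Fin (d + 1) → ℝ} {u : Fin (X.m + 1) → ℝ}

theorem typeLE_cut_iff {a b : Fin X.m} :
    X.typeLE (X.partition.cut a) (X.partition.cut b) ↔ X.tree.labelLE a b := by
  have hcut := X.partition.cut_strictMono.injective
  simp only [typeLE, OrderedPartition.typeEntry_eq_iff, hcut.eq_iff]
  exact ⟨fun ⟨_, _, ha, hb, hab⟩ => ha ▸ hb ▸ hab, fun hab => ⟨a, b, rfl, rfl, hab⟩⟩

theorem isMinimalType_cut {a : Fin X.m}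
    (ha : ∀ k : Fin X.m, X.tree.labelLE k a → X.tree.labelLE a k) :
    X.IsMinimalType (X.partition.cut a) := by
  refine ⟨⟨a, OrderedPartition.typeEntry_eq_iff.2 rfl⟩, fun j hj => ?_⟩
  obtain ⟨k, _, hk, _⟩ := id hj
  obtain rfl := OrderedPartition.typeEntry_eq_iff.1 hk
  exact typeLE_cut_iff.2 (ha k (typeLE_cut_iff.1 hj))

theorem exists_eq_comp_of_mk_mem_cone (hw : (Submodule.Quotient.mk w : W d) ∈ X.cone) :
    ∃ u, Monotone u ∧ X.tree.IsAdapted (gap u) ∧ w = u ∘ X.partition.blockIndex := by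
  obtain ⟨hconst, π, hπ, hle, hmin⟩ := hw
  rw [OrderedPartition.permPartition_refines_iff] at hπ
  obtain ⟨u, rfl⟩ : ∃ u, w = u ∘ X.partition.blockIndex := by
    refine (Function.factorsThrough_iff w).1 fun x y hxy => ?_
    exact sub_eq_zero.1 (hconst _ y (X.partition.mem_block_iff.2 rfl) x
      (X.partition.mem_block_iff.2 hxy))
  have hD (a : Fin X.m) :
      D π (X.partition.cut a) (Submodule.Quotient.mk (u ∘ X.partition.blockIndex)) = gap u a := by
    rw [D_mk, OrderedPartition.gap_comp_symm_cut hπ]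
  have hadapted : X.tree.IsAdapted (gap u) := fun a b hab => by
    simpa only [hD] using hle _ _ (typeLE_cut_iff.2 hab)
  refine ⟨u, monotone_iff_gap_nonneg.2 fun a => ?_, hadapted, rfl⟩
  obtain ⟨c, hca, hc⟩ := X.tree.exists_minimal_labelLE a
  exact ((hmin _ (isMinimalType_cut hc)).trans_eq (hD c)).trans (hadapted c a hca)

theorem mk_comp_blockIndex_mem_cone (hu : Monotone u) (hgap : X.tree.IsAdapted (gap u)) :
    (Submodule.Quotient.mk (u ∘ X.partition.blockIndex) : W d) ∈ X.cone := by
  let π := (Tuple.sort X.partition.blockIndex).symm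
  have hπ : Monotone (X.partition.blockIndex ∘ π.symm) := Tuple.monotone_sort _
  refine ⟨fun a i hi j hj => ?_, π, (X.partition.permPartition_refines_iff).2 hπ, ?_, fun i _ => ?_⟩
  · rw [OrderedPartition.mem_block_iff] at hi hj
    simp only [coordDiff_mk, Function.comp_apply, hi, hj, sub_self]
  · rintro i j ⟨a, b, ha, hb, hab⟩
    obtain rfl := OrderedPartition.typeEntry_eq_iff.1 ha
    obtain rfl := OrderedPartition.typeEntry_eq_iff.1 hb
    simpa only [D_mk, OrderedPartition.gap_comp_symm_cut hπ] using hgap a b hab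
  · exact monotone_iff_gap_nonneg.1 (hu.comp hπ) i

theorem mk_mem_cone_iff : (Submodule.Quotient.mk w : W d) ∈ X.cone ↔
    ∃ u, Monotone u ∧ X.tree.IsAdapted (gap u) ∧ w = u ∘ X.partition.blockIndex :=
  ⟨exists_eq_comp_of_mk_mem_cone,
    fun ⟨_, hu, hgap, hw⟩ => hw ▸ mk_comp_blockIndex_mem_cone hu hgap⟩

/-- `w₀` represents a point in the relative interior of the cone of `X`: all inequalities that
define the cone hold strictly, unless they are equalities on the whole cone. -/
def IsInterior (X : PartitionLabeledTree d) (w₀ : Fin (d + 1) → ℝ) : Prop :=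
  ∃ u₀, StrictMono u₀ ∧ X.tree.IsCartesianTree (gap u₀) ∧ w₀ = u₀ ∘ X.partition.blockIndex

theorem exists_isInterior (X : PartitionLabeledTree d) : ∃ w₀, X.IsInterior w₀ := by
  let g (a : Fin X.m) : ℝ := 2⁻¹ ^ (X.tree.labelVertex a).length
  have hg : StrictMono (Fin.partialSum g) := strictMono_iff_gap_pos.2 fun a => by
    rw [gap_partialSum]
    positivity
  refine ⟨_, Fin.partialSum g, hg, ?_, rfl⟩
  rw [gap_partialSum]
  exact PlaneTree.isCartesianTree_of_strictAnti X.tree_mem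
    (pow_right_strictAnti₀ (by norm_num) (by norm_num))

theorem exists_isInterior_of_vector (w₀ : Fin (d + 1) → ℝ) :
    ∃ X : PartitionLabeledTree d, X.IsInterior w₀ := by
  obtain ⟨m, f, u, hf, hu, rfl⟩ := exists_surjective_strictMono_eq_comp w₀
  obtain ⟨T, hT, hTu⟩ := PlaneTree.exists_isCartesianTree (gap u)
  exact ⟨⟨m, .ofSurjective f hf, T, hT⟩, u, hu, hTu,
    by rw [OrderedPartition.blockIndex_ofSurjective hf]⟩

theorem IsInterior.blockIndex_le_iff (h : X.IsInterior w₀) {x y : Fin (d + 1)} :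
    X.partition.blockIndex x ≤ X.partition.blockIndex y ↔ w₀ x ≤ w₀ y := by
  obtain ⟨u₀, hu₀, -, rfl⟩ := h
  exact hu₀.le_iff_le.symm

theorem IsInterior.monotone_comp_iff (h : X.IsInterior w₀) {π : Equiv.Perm (Fin (d + 1))} :
    Monotone (X.partition.blockIndex ∘ π.symm) ↔ Monotone (w₀ ∘ π.symm) := by
  simp only [Monotone, Function.comp_apply, h.blockIndex_le_iff]

theorem IsInterior.sortedAdapted (h : X.IsInterior w₀) (hu : Monotone u)
    (hgap : X.tree.IsAdapted (gap u)) {π : Equiv.Perm (Fin (d + 1))} {T : PlaneTree}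
    (hT : T ∈ trees d) (hπT : SortedAdapted w₀ π T) :
    SortedAdapted (u ∘ X.partition.blockIndex) π T := by
  have hπ := h.monotone_comp_iff.2 hπT.1
  obtain ⟨u₀, hu₀, hX, rfl⟩ := h
  have hmono : Monotone ((u ∘ X.partition.blockIndex) ∘ π.symm) := hu.comp hπ
  refine ⟨hmono, fun i j hij => ?_⟩
  by_cases hi : i ∈ Set.range X.partition.cut
  swap
  · rw [OrderedPartition.gap_comp_symm_eq_zero hπ hi]
    exact monotone_iff_gap_nonneg.1 hmono j
  obtain ⟨a, rfl⟩ := hi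
  by_cases hj : j ∈ Set.range X.partition.cut
  swap
  · have hle := hπT.2 _ _ hij
    rw [OrderedPartition.gap_comp_symm_eq_zero hπ hj, OrderedPartition.gap_comp_symm_cut hπ] at hle
    exact absurd hle (strictMono_iff_gap_pos.1 hu₀ a).not_ge
  obtain ⟨b, rfl⟩ := hj
  rw [OrderedPartition.gap_comp_symm_cut hπ, OrderedPartition.gap_comp_symm_cut hπ]
  refine hgap a b ((hX a b).2 fun c hc => ?_)
  have hcut : X.partition.cut c ∈ Set.uIcc (X.partition.cut a) (X.partition.cut b) :=
    X.partition.cut_strictMono.monotone.mapsTo_uIcc hc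
  simpa only [OrderedPartition.gap_comp_symm_cut hπ] using
    hπT.2 _ _ (PlaneTree.labelLE_of_mem_uIcc hT hij hcut)

theorem IsInterior.exists_eq_comp (h : X.IsInterior w₀)
    (hw : ∀ π, ∀ T ∈ treesInternal d d, SortedAdapted w₀ π T → SortedAdapted w π T) :
    ∃ u, Monotone u ∧ w = u ∘ X.partition.blockIndex := by
  refine exists_monotone_eq_comp X.partition.blockIndex_surjective fun x y hxy => ?_
  obtain ⟨π, hπ, hxy⟩ := exists_perm_monotone_and_le w₀ (h.blockIndex_le_iff.1 hxy)
  obtain ⟨T, hT, hTw₀⟩ := PlaneTree.exists_binary_isAdapted (gap (w₀ ∘ π.symm))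
  simpa using (hw π T hT ⟨hπ, hTw₀⟩).1 hxy

theorem IsInterior.isAdapted_gap (h : X.IsInterior w₀)
    (hu : ∀ π, ∀ T ∈ treesInternal d d, SortedAdapted w₀ π T →
      SortedAdapted (u ∘ X.partition.blockIndex) π T) : X.tree.IsAdapted (gap u) := by
  intro a b hab
  let π := (Tuple.sort w₀).symm
  have hπ₀ : Monotone (w₀ ∘ π.symm) := Tuple.monotone_sort w₀
  have hπ := h.monotone_comp_iff.2 hπ₀
  obtain ⟨u₀, -, hX, rfl⟩ := h
  have hle : ∀ k ∈ Set.uIcc (X.partition.cut a) (X.partition.cut b),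
      gap ((u₀ ∘ X.partition.blockIndex) ∘ π.symm) k ≤
        gap ((u₀ ∘ X.partition.blockIndex) ∘ π.symm) (X.partition.cut b) := by
    intro k hk
    by_cases hkc : k ∈ Set.range X.partition.cut
    · obtain ⟨c, rfl⟩ := hkc
      rw [OrderedPartition.gap_comp_symm_cut hπ, OrderedPartition.gap_comp_symm_cut hπ]
      refine (hX a b).1 hab c ?_
      simpa [Set.mem_uIcc, X.partition.cut_strictMono.le_iff_le] using hk
    · rw [OrderedPartition.gap_comp_symm_eq_zero hπ hkc]
      exact monotone_iff_gap_nonneg.1 hπ₀ _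
  obtain ⟨T, hT, hTw₀, hTab⟩ := PlaneTree.exists_binary_isAdapted_labelLE hle
  simpa only [OrderedPartition.gap_comp_symm_cut hπ] using (hu π T hT ⟨hπ₀, hTw₀⟩).2 _ _ hTab

theorem IsInterior.mk_mem_cone_iff (h : X.IsInterior w₀) :
    (Submodule.Quotient.mk w : W d) ∈ X.cone ↔
      ∀ π, ∀ T ∈ treesInternal d d, SortedAdapted w₀ π T → SortedAdapted w π T := by
  rw [PartitionLabeledTree.mk_mem_cone_iff]
  refine ⟨fun ⟨u, hu, hgap, hw⟩ π T hT hπT => hw ▸ h.sortedAdapted hu hgap hT.1 hπT, fun hw => ?_⟩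
  obtain ⟨u, hu, rfl⟩ := h.exists_eq_comp hw
  exact ⟨u, hu, h.isAdapted_gap hw, rfl⟩

end PartitionLabeledTree

theorem mk_mem_permCone_iff {d : ℕ} {π : Equiv.Perm (Fin (d + 1))} {T : PlaneTree}
    {hT : T ∈ trees d} {w : Fin (d + 1) → ℝ} :
    (Submodule.Quotient.mk w : W d) ∈ permCone π T hT ↔ SortedAdapted w π T := by
  rw [permCone, PartitionLabeledTree.mk_mem_cone_iff, OrderedPartition.blockIndex_permPartition]
  refine ⟨?_, fun h => ⟨w ∘ π.symm, h.1, h.2, by simp [Function.comp_assoc]⟩⟩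
  rintro ⟨u, hu, hgap, rfl⟩
  simpa only [SortedAdapted, Function.comp_assoc, Equiv.self_comp_symm, Function.comp_id] using
    And.intro hu hgap

/-! ### Faces of convex hulls -/

section ConvexHull

variable {E : Type*} [AddCommGroup E] [Module ℝ E] {S : Set E} {l : Module.Dual ℝ E}

/-- The points of `S` at which the functional `l` attains its maximum over `S`. -/
def maximizers (S : Set E) (l : Module.Dual ℝ E) : Set E := {x | x ∈ S ∧ ∀ y ∈ S, l y ≤ l x}

theorem forall_mem_convexHull_le_iff {c : ℝ} : (∀ y ∈ convexHull ℝ S, l y ≤ c) ↔ ∀ y ∈ S, l y ≤ c :=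
  ⟨fun h y hy => h y (subset_convexHull ℝ S hy),
    fun h _ hy => convexHull_min h (convex_halfSpace_le l.isLinear c) hy⟩

theorem convex_maximizers (hS : Convex ℝ S) : Convex ℝ (maximizers S l) := by
  refine hS.inter fun x hx y hy a b ha hb hab z hz => ?_
  calc l z = a * l z + b * l z := by rw [← add_mul, hab, one_mul]
    _ ≤ a * l x + b * l y := by gcongr; exacts [hx z hz, hy z hz]
    _ = l (a • x + b • y) := by simp only [map_add, map_smul, smul_eq_mul]

theorem maximizers_convexHull : maximizers (convexHull ℝ S) l = convexHull ℝ (maximizers S l) := by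
  refine Set.Subset.antisymm ?_ (convexHull_min ?_ ?_)
  · rintro x ⟨hx, hmax⟩
    rw [forall_mem_convexHull_le_iff] at hmax
    obtain ⟨ι, _, z, c, hzS, -, hc, hc1, rfl⟩ := eq_pos_convex_span_of_mem_convexHull hx
    set x := ∑ i, c i • z i
    have hz (i : ι) : l (z i) = l x := by
      have hsum : ∑ i, c i * l (z i) = ∑ i, c i * l x := by
        rw [← Finset.sum_mul, hc1, one_mul]
        simp [x]
      have hle (i : ι) : c i * l (z i) ≤ c i * l x :=
        mul_le_mul_of_nonneg_left (hmax _ (hzS ⟨i, rfl⟩)) (hc i).le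
      exact mul_left_cancel₀ (hc i).ne'
        ((Finset.sum_eq_sum_iff_of_le fun i _ => hle i).1 hsum i (Finset.mem_univ i))
    refine (convex_convexHull ℝ _).sum_mem (fun i _ => (hc i).le) hc1 fun i _ => ?_
    exact subset_convexHull ℝ _ ⟨hzS ⟨i, rfl⟩, fun y hy => (hmax y hy).trans_eq (hz i).symm⟩
  · exact fun x hx => ⟨subset_convexHull ℝ S hx.1, forall_mem_convexHull_le_iff.2 hx.2⟩
  · exact convex_maximizers (convex_convexHull ℝ S)

theorem mem_maximizers_convexHull_iff {x : E} (hx : x ∈ S) :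
    x ∈ maximizers (convexHull ℝ S) l ↔ x ∈ maximizers S l :=
  and_congr (iff_of_true (subset_convexHull ℝ S hx) hx) forall_mem_convexHull_le_iff

theorem vertexSet_convexHull : vertexSet (convexHull ℝ S) = {v | ∃ l, maximizers S l = {v}} := by
  ext v
  refine (and_iff_right (Set.singleton_nonempty v)).trans (exists_congr fun l => ?_)
  rw [← convexHull_eq_singleton (𝕜 := ℝ), ← maximizers_convexHull, eq_comm, maximizers]

end ConvexHull

/-! ### Fans from families of linear functionals -/

section Cone

variable {E : Type*} [AddCommGroup E] [Module ℝ E] {C F : Set E}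

theorem isNonemptyFace_of_forall_nonpos (h0 : (0 : E) ∈ C) {l : Module.Dual ℝ E}
    (hl : ∀ y ∈ C, l y ≤ 0) : IsNonemptyFace C {x | x ∈ C ∧ l x = 0} := by
  refine ⟨⟨0, h0, map_zero l⟩, l, Set.ext fun x => and_congr_right fun hx => ?_⟩
  exact ⟨fun h y hy => (hl y hy).trans_eq h.symm,
    fun h => (hl x hx).antisymm ((map_zero l).symm.trans_le (h 0 h0))⟩

theorem IsNonemptyFace.exists_forall_nonpos (hF : IsNonemptyFace C F)
    (hC : ∀ c : ℝ, 0 ≤ c → ∀ x ∈ C, c • x ∈ C) :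
    ∃ l : Module.Dual ℝ E, (∀ y ∈ C, l y ≤ 0) ∧ F = {x | x ∈ C ∧ l x = 0} := by
  obtain ⟨⟨x₀, hx₀⟩, l, rfl⟩ := hF
  have h0 : (0 : E) ∈ C := zero_smul ℝ x₀ ▸ hC 0 le_rfl x₀ hx₀.1
  have hlx₀ : l x₀ = 0 := by
    have h1 : l 0 ≤ l x₀ := hx₀.2 0 h0
    have h2 : l ((2 : ℝ) • x₀) ≤ l x₀ := hx₀.2 _ (hC 2 zero_le_two x₀ hx₀.1)
    rw [map_zero] at h1
    rw [map_smul, smul_eq_mul] at h2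
    linarith
  have hl : ∀ y ∈ C, l y ≤ 0 := fun y hy => (hx₀.2 y hy).trans_eq hlx₀
  refine ⟨l, hl, Set.ext fun x => and_congr_right fun hx => ?_⟩
  exact ⟨fun h => (hl x hx).antisymm (hlx₀.symm.trans_le (h x₀ hx₀.1)),
    fun h y hy => (hl y hy).trans_eq h.symm⟩

end Cone

section MaxCone

variable {E ι : Type*} [AddCommGroup E] [Module ℝ E]

/-- The indices of the members of the family `φ` whose value at `w` is the largest. -/
def maxSet (φ : ι → Module.Dual ℝ E) (w : E) : Set ι := {s | ∀ t, φ t w ≤ φ s w}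

/-- The cone of the points at which all members of the family `φ` that are largest at `w₀` are
largest. If the `φ s` are the dot products with the points of a finite set, this is the normal cone
at the face of the convex hull on which `w₀` is maximal. -/
def maxCone (φ : ι → Module.Dual ℝ E) (w₀ : E) : Set E := {w | maxSet φ w₀ ⊆ maxSet φ w}

variable {φ : ι → Module.Dual ℝ E} {w w' w₀ w₁ : E} {s t : ι}

theorem mem_maxSet_iff_eq (hs : s ∈ maxSet φ w) : t ∈ maxSet φ w ↔ φ t w = φ s w :=
  ⟨fun ht => (hs t).antisymm (ht s), fun h r => (hs r).trans_eq h.symm⟩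

theorem maxSet_add (hs : s ∈ maxSet φ w) (hs' : s ∈ maxSet φ w') :
    maxSet φ (w + w') = maxSet φ w ∩ maxSet φ w' := by
  have hadd : s ∈ maxSet φ (w + w') := fun t => by
    simpa only [map_add] using add_le_add (hs t) (hs' t)
  ext t
  rw [Set.mem_inter_iff, mem_maxSet_iff_eq hadd, mem_maxSet_iff_eq hs, mem_maxSet_iff_eq hs',
    map_add, map_add]
  exact add_eq_add_iff_eq_and_eq (hs t) (hs' t)

theorem zero_mem_maxCone : 0 ∈ maxCone φ w₀ := fun s _ t => by simp only [map_zero, le_rfl]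

theorem smul_mem_maxCone {c : ℝ} (hc : 0 ≤ c) (hw : w ∈ maxCone φ w₀) : c • w ∈ maxCone φ w₀ :=
  fun s hs t => by simpa only [map_smul] using smul_le_smul_of_nonneg_left (hw hs t) hc

theorem isCompleteFan_range_maxCone (φ : ι → Module.Dual ℝ E) :
    IsCompleteFan (Set.range (maxCone φ)) :=
  Set.eq_univ_of_forall fun w => ⟨_, ⟨w, rfl⟩, fun _ hs => hs⟩

-- `w₁` lies in the relative interior of its cone.
theorem exists_smul_sub_mem_maxCone [Finite ι] (hw : w ∈ maxCone φ w₁) :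
    ∃ c : ℝ, c • w₁ - w ∈ maxCone φ w₁ := by
  obtain ⟨c, hc⟩ := Finite.exists_le fun p : ι × ι =>
    (φ p.1 w - φ p.2 w) / (φ p.1 w₁ - φ p.2 w₁)
  refine ⟨c, fun s hs t => ?_⟩
  simp only [map_sub, map_smul, smul_eq_mul]
  rcases (hs t).eq_or_lt with h | h
  · rw [h, (mem_maxSet_iff_eq (hw hs)).1 (hw ((mem_maxSet_iff_eq hs).2 h))]
  · have hst := hc (s, t)
    rw [div_le_iff₀ (sub_pos.2 h)] at hst
    linarith

theorem isPolyhedralCone_maxCone [Finite ι] : IsPolyhedralCone (maxCone φ w₀) := by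
  refine ⟨(Set.toFinite (Set.image2 (fun s t => φ s - φ t) (maxSet φ w₀) Set.univ)).toFinset,
    Set.ext fun w => ?_⟩
  simp only [Set.Finite.mem_toFinset, Set.mem_ofPred_eq, Set.forall_mem_image2, Set.mem_univ,
    forall_const, LinearMap.sub_apply, sub_nonneg]
  rfl

variable [Finite ι] [Nonempty ι]

theorem maxSet_nonempty (φ : ι → Module.Dual ℝ E) (w : E) : (maxSet φ w).Nonempty :=
  Finite.exists_max fun s => φ s w

theorem isNonemptyFace_maxCone_inter :
    IsNonemptyFace (maxCone φ w₀) (maxCone φ w₀ ∩ maxCone φ w₁) := by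
  obtain ⟨s, hs⟩ := maxSet_nonempty φ w₀
  have hfin := Set.toFinite (maxSet φ w₁)
  have hle : ∀ w ∈ maxCone φ w₀, ∀ t ∈ hfin.toFinset, (φ t - φ s) w ≤ 0 := fun w hw t _ =>
    sub_nonpos.2 (hw hs t)
  have heq : maxCone φ w₀ ∩ maxCone φ w₁ =
      {w | w ∈ maxCone φ w₀ ∧ (∑ t ∈ hfin.toFinset, (φ t - φ s)) w = 0} := by
    refine Set.ext fun w => and_congr_right fun hw => ?_
    rw [LinearMap.sum_apply, Finset.sum_eq_zero_iff_of_nonpos (hle w hw)]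
    simp only [hfin.mem_toFinset, LinearMap.sub_apply, sub_eq_zero, ← mem_maxSet_iff_eq (hw hs)]
    rfl
  rw [heq]
  refine isNonemptyFace_of_forall_nonpos zero_mem_maxCone fun w hw => ?_
  rw [LinearMap.sum_apply]
  exact Finset.sum_nonpos (hle w hw)

theorem IsNonemptyFace.mem_range_maxCone {F : Set E} (hF : IsNonemptyFace (maxCone φ w₀) F) :
    F ∈ Set.range (maxCone φ) := by
  obtain ⟨l, hl, hFl⟩ := hF.exists_forall_nonpos fun c hc _ => smul_mem_maxCone hc
  obtain ⟨w₁, hw₁F, hmin⟩ := exists_minimalFor_of_wellFoundedLT (· ∈ F) (maxSet φ) hF.1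
  obtain ⟨hw₁, hlw₁⟩ := hFl ▸ hw₁F
  have hsub : maxCone φ w₁ ⊆ maxCone φ w₀ := fun w hw => Set.Subset.trans hw₁ hw
  refine ⟨w₁, Set.Subset.antisymm (fun w hw => ?_) fun w hwF => ?_⟩
  · obtain ⟨c, hc⟩ := exists_smul_sub_mem_maxCone hw
    have hle := hl _ (hsub hc)
    rw [map_sub, map_smul, hlw₁, smul_zero, zero_sub, neg_nonpos] at hle
    rw [hFl]
    exact ⟨hsub hw, (hl w (hsub hw)).antisymm hle⟩
  · obtain ⟨hw, hlw⟩ := hFl ▸ hwF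
    obtain ⟨s, hs⟩ := maxSet_nonempty φ w₀
    have hadd := maxSet_add (hw₁ hs) (hw hs)
    have hsumF : w₁ + w ∈ F := by
      rw [hFl]
      refine ⟨?_, by rw [map_add, hlw₁, hlw, add_zero]⟩
      rw [maxCone, Set.mem_ofPred_eq, hadd]
      exact Set.subset_inter hw₁ hw
    have hsub := hmin hsumF (hadd.trans_subset Set.inter_subset_left)
    exact (hsub.trans_eq hadd).trans Set.inter_subset_right

variable (φ)

theorem isFan_range_maxCone : IsFan (Set.range (maxCone φ)) where
  finite := (Set.finite_range fun A : Set ι => {w | A ⊆ maxSet φ w}).subset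
    (Set.range_subset_iff.2 fun w => ⟨maxSet φ w, rfl⟩)
  polyhedral := Set.forall_mem_range.2 fun _ => isPolyhedralCone_maxCone
  face_mem := Set.forall_mem_range.2 fun _ _ => IsNonemptyFace.mem_range_maxCone
  inter_face := Set.forall_mem_range.2 fun _ => Set.forall_mem_range.2 fun w' =>
    ⟨isNonemptyFace_maxCone_inter, Set.inter_comm (maxCone φ w') _ ▸ isNonemptyFace_maxCone_inter⟩

end MaxCone

/-! ### Polytopes in a translate of `V_d` -/

section Polytope

open scoped Matrix

variable {d : ℕ} {α w w₀ x y : Fin (d + 1) → ℝ} {F P S : Set (Fin (d + 1) → ℝ)}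

theorem mem_V : x ∈ V d ↔ ∑ i, x i = 0 := Iff.rfl

theorem mem_U : x ∈ U α ↔ ∑ i, x i = ∑ i, α i := Iff.rfl

theorem sub_mem_V (hx : x ∈ U α) (hy : y ∈ U α) : x - y ∈ V d := by
  simp only [mem_V, Pi.sub_apply, Finset.sum_sub_distrib, mem_U.1 hx, mem_U.1 hy, sub_self]

theorem coe_mk'_V (α : Fin (d + 1) → ℝ) :
    (AffineSubspace.mk' α (V d) : Set (Fin (d + 1) → ℝ)) = U α := by
  ext x
  simp [AffineSubspace.mem_mk', mem_V, mem_U, Finset.sum_sub_distrib, sub_eq_zero]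

theorem convexHull_subset_U (hS : S ⊆ U α) : convexHull ℝ S ⊆ U α := by
  rw [← coe_mk'_V] at hS ⊢
  exact convexHull_min hS (AffineSubspace.convex _)

theorem single_sub_single_mem_vectorSpan {ι : Type*} [DecidableEq ι] {x : ι → ℝ} {S : Set (ι → ℝ)}
    (hx : Function.Injective x) (hS : ∀ π : Equiv.Perm ι, x ∘ π ∈ S) (a b : ι) :
    (Pi.single a 1 - Pi.single b 1 : ι → ℝ) ∈ vectorSpan ℝ S := by
  rcases eq_or_ne a b with rfl | hab
  · simp only [sub_self, zero_mem]
  have hswap : x ∘ (1 : Equiv.Perm ι) -ᵥ x ∘ Equiv.swap a b =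
      (x a - x b) • (Pi.single a 1 - Pi.single b 1 : ι → ℝ) := by
    funext i
    rcases eq_or_ne i a with rfl | ha
    · simp [hab]
    rcases eq_or_ne i b with rfl | hb
    · simp [hab.symm]
    · simp [Equiv.swap_apply_of_ne_of_ne ha hb, ha, hb]
  have hmem := vsub_mem_vectorSpan ℝ (hS 1) (hS (Equiv.swap a b))
  rw [hswap] at hmem
  exact (Submodule.smul_mem_iff _ (sub_ne_zero.2 (hx.ne hab))).1 hmem

theorem V_le_of_single_sub_single_mem {p : Submodule ℝ (Fin (d + 1) → ℝ)}
    (hp : ∀ i, (Pi.single i 1 - Pi.single 0 1 : Fin (d + 1) → ℝ) ∈ p) : V d ≤ p := by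
  intro x hx
  have hsum : x = ∑ i, x i • (Pi.single i 1 - Pi.single 0 1 : Fin (d + 1) → ℝ) := by
    simp only [smul_sub, Finset.sum_sub_distrib, ← Finset.sum_smul, mem_V.1 hx, zero_smul,
      sub_zero]
    exact pi_eq_sum_univ' x
  rw [hsum]
  exact p.sum_mem fun i _ => p.smul_mem _ (hp i)

theorem affineSpan_eq_U (hSU : S ⊆ U α) (hx : Function.Injective x)
    (hS : ∀ π : Equiv.Perm (Fin (d + 1)), x ∘ π ∈ S) :
    (affineSpan ℝ S : Set (Fin (d + 1) → ℝ)) = U α := by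
  rw [← coe_mk'_V] at hSU ⊢
  have hle := affineSpan_le.2 hSU
  refine congrArg _ (AffineSubspace.eq_of_direction_eq_of_nonempty_of_le
    ((AffineSubspace.direction_le hle).antisymm ?_) ⟨_, mem_affineSpan ℝ (hS 1)⟩ hle)
  rw [AffineSubspace.direction_mk', direction_affineSpan]
  exact V_le_of_single_sub_single_mem fun i => single_sub_single_mem_vectorSpan hx hS i 0

theorem mk_mem_ncone_iff (hFP : F ⊆ P) (hP : P ⊆ U α) :
    Submodule.Quotient.mk w ∈ ncone F P ↔
      F ⊆ maximizers P (dotProductEquiv ℝ (Fin (d + 1)) w) := by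
  have hpairing (y y' : Fin (d + 1) → ℝ) (h : y - y' ∈ V d) :
      0 ≤ pairing d (Submodule.Quotient.mk w) ⟨y - y', h⟩ ↔ w ⬝ᵥ y' ≤ w ⬝ᵥ y := by
    rw [← sub_nonneg (a := w ⬝ᵥ y), ← dotProduct_sub]
    rfl
  refine forall₂_congr fun y hy => ?_
  simp only [hpairing, maximizers, Set.mem_ofPred_eq, hFP hy, true_and, dotProductEquiv_apply_apply]
  exact forall₂_congr fun y' hy' => forall_prop_of_true (sub_mem_V (hP (hFP hy)) (hP hy'))

/-- The functionals on `W_d` given by the points of `S`, up to the choice of `α` as an origin. -/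
noncomputable def pointFunctional (hS : S ⊆ U α) (x : S) : Module.Dual ℝ (W d) :=
  (pairing d).flip ⟨x - α, sub_mem_V (hS x.2) rfl⟩

theorem pointFunctional_mk (hS : S ⊆ U α) (x : S) :
    pointFunctional hS x (Submodule.Quotient.mk w) = w ⬝ᵥ x - w ⬝ᵥ α :=
  dotProduct_sub w x α

theorem mem_maxSet_pointFunctional_iff (hS : S ⊆ U α) {x : S} :
    x ∈ maxSet (pointFunctional hS) (Submodule.Quotient.mk w) ↔
      ↑x ∈ maximizers S (dotProductEquiv ℝ (Fin (d + 1)) w) := by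
  simp [maxSet, maximizers, pointFunctional_mk]

theorem mk_mem_maxCone_pointFunctional_iff (hS : S ⊆ U α) :
    Submodule.Quotient.mk w ∈ maxCone (pointFunctional hS) (Submodule.Quotient.mk w₀) ↔
      maximizers S (dotProductEquiv ℝ (Fin (d + 1)) w₀) ⊆
        maximizers S (dotProductEquiv ℝ (Fin (d + 1)) w) := by
  refine ⟨fun h x hx => ?_, fun h x hx => ?_⟩
  · exact (mem_maxSet_pointFunctional_iff hS (x := ⟨x, hx.1⟩)).1
      (h ((mem_maxSet_pointFunctional_iff hS).2 hx))
  · exact (mem_maxSet_pointFunctional_iff hS).2 (h ((mem_maxSet_pointFunctional_iff hS).1 hx))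

theorem ncone_maximizers_convexHull (hS : S ⊆ U α) :
    ncone (maximizers (convexHull ℝ S) (dotProductEquiv ℝ (Fin (d + 1)) w₀)) (convexHull ℝ S) =
      maxCone (pointFunctional hS) (Submodule.Quotient.mk w₀) := by
  ext w
  obtain ⟨w, rfl⟩ := Submodule.Quotient.mk_surjective _ w
  rw [mk_mem_ncone_iff (fun _ h => h.1) (convexHull_subset_U hS),
    mk_mem_maxCone_pointFunctional_iff, maximizers_convexHull,
    (convex_maximizers (convex_convexHull ℝ S)).convexHull_subset_iff]
  exact forall₂_congr fun x hx => mem_maximizers_convexHull_iff hx.1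

theorem normalFan_convexHull [Finite S] [Nonempty S] (hS : S ⊆ U α) :
    normalFan (convexHull ℝ S) = Set.range (maxCone (pointFunctional hS)) := by
  ext C
  constructor
  · rintro ⟨F, ⟨-, l, rfl⟩, rfl⟩
    obtain ⟨w₀, rfl⟩ := (dotProductEquiv ℝ (Fin (d + 1))).surjective l
    exact ⟨_, (ncone_maximizers_convexHull hS).symm⟩
  · rintro ⟨w₀, rfl⟩
    obtain ⟨w₀, rfl⟩ := Submodule.Quotient.mk_surjective _ w₀
    obtain ⟨x, hx⟩ := maxSet_nonempty (pointFunctional hS) (Submodule.Quotient.mk w₀)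
    refine ⟨_, ⟨⟨x, ?_⟩, _, rfl⟩, (ncone_maximizers_convexHull hS).symm⟩
    exact (mem_maximizers_convexHull_iff x.2).2 ((mem_maxSet_pointFunctional_iff hS).1 hx)

theorem isFan_normalFan_convexHull [Finite S] [Nonempty S] (hS : S ⊆ U α) :
    IsFan (normalFan (convexHull ℝ S)) :=
  normalFan_convexHull hS ▸ isFan_range_maxCone _

theorem isCompleteFan_normalFan_convexHull [Finite S] [Nonempty S] (hS : S ⊆ U α) :
    IsCompleteFan (normalFan (convexHull ℝ S)) :=
  normalFan_convexHull hS ▸ isCompleteFan_range_maxCone _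

theorem isProjective_normalFan_convexHull [Finite S] [Nonempty S] (hS : S ⊆ U α) :
    IsProjective (normalFan (convexHull ℝ S)) :=
  ⟨α, S.toFinite.toFinset, S.toFinite.toFinset_nonempty.2 .of_subtype,
    by rwa [Set.Finite.coe_toFinset], by rw [Set.Finite.coe_toFinset]⟩

end Polytope

/-! ### The maximizers of a functional over the points `v_{π,T}` -/

section PermAsso

open scoped Matrix

variable {d : ℕ} {α : Fin (d + 1) → ℝ} {β : Fin d → ℝ} {w w₀ : Fin (d + 1) → ℝ}
  {π π' : Equiv.Perm (Fin (d + 1))} {T T' : PlaneTree}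

theorem vpt_eq_comp (α : Fin (d + 1) → ℝ) (β : Fin d → ℝ) (π : Equiv.Perm (Fin (d + 1)))
    (T : PlaneTree) : vpt α β π T = vpt α β 1 T ∘ π := by
  have one_symm (i) : (1 : Equiv.Perm (Fin (d + 1))).symm i = i := rfl
  ext i
  simp [vpt, fvec, Pi.single_apply, one_symm, Equiv.eq_symm_apply]

theorem dotProduct_vpt : w ⬝ᵥ vpt α β π T = (w ∘ π.symm) ⬝ᵥ vpt α β 1 T := by
  rw [vpt_eq_comp, comp_equiv_symm_dotProduct]

theorem dotProduct_vpt_eq_add :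
    w ⬝ᵥ vpt α β π T = (w ∘ π.symm) ⬝ᵥ α + ∑ i, treeCoeff β T i * gap (w ∘ π.symm) i := by
  simp only [vpt, dotProduct_add, dotProduct_sum, dotProduct_smul, fvec, dotProduct_sub,
    dotProduct_single, mul_one, smul_eq_mul]
  simp [dotProduct, gap, mul_comm]

theorem vpt_mem_U : vpt α β π T ∈ U α := by
  have h := dotProduct_vpt_eq_add (w := 1) (α := α) (β := β) (π := π) (T := T)
  simpa [gap, mem_U, one_dotProduct] using h

theorem permAssoPoints_subset_U : permAssoPoints α β ⊆ U α := by
  rintro _ ⟨π, T, -, rfl⟩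
  exact vpt_mem_U

instance : Finite (permAssoPoints α β) := by
  refine Set.Finite.to_subtype <| (Set.finite_univ.image2 (fun (π : Equiv.Perm (Fin (d + 1))) c =>
    ∑ i, α i • (Pi.single (π.symm i) 1 : Fin (d + 1) → ℝ) + ∑ i, c i • fvec π i)
    (finite_image_treeCoeff β)).subset ?_
  rintro _ ⟨π, T, hT, rfl⟩
  exact ⟨π, trivial, _, ⟨T, hT, rfl⟩, rfl⟩

instance : Nonempty (permAssoPoints α β) :=
  have ⟨π, T, hT, _⟩ := exists_sortedAdapted (0 : Fin (d + 1) → ℝ)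
  ⟨_, π, T, hT, rfl⟩

theorem dotProduct_vpt_le_of_monotone (hT : Monotone (vpt α β 1 T)) (hw : Monotone (w ∘ π.symm)) :
    w ⬝ᵥ vpt α β π' T ≤ w ⬝ᵥ vpt α β π T := by
  have hperm : w ∘ π'.symm = (w ∘ π.symm) ∘ π'.symm.trans π := by
    ext i
    simp
  rw [dotProduct_vpt (π := π'), dotProduct_vpt (π := π), hperm]
  exact (hw.monovary hT).sum_comp_perm_mul_le_sum_mul

theorem dotProduct_vpt_eq_iff_monotone (hT : StrictMono (vpt α β 1 T))
    (hw : Monotone (w ∘ π.symm)) :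
    w ⬝ᵥ vpt α β π' T = w ⬝ᵥ vpt α β π T ↔ Monotone (w ∘ π'.symm) := by
  have hperm : w ∘ π'.symm = (w ∘ π.symm) ∘ π'.symm.trans π := by
    ext i
    simp
  rw [dotProduct_vpt (π := π'), dotProduct_vpt (π := π), hperm]
  exact (hw.monovary hT.monotone).sum_comp_perm_mul_eq_sum_mul_iff.trans
    ⟨hT.trans_monovary, fun h => h.monovary hT.monotone⟩

theorem dotProduct_vpt_le_of_isAdapted (hβ : StrictMono β) (hT : T ∈ treesInternal d d)
    (hT' : T' ∈ treesInternal d d) (h : T.IsAdapted (gap (w ∘ π.symm))) :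
    w ⬝ᵥ vpt α β π T' ≤ w ⬝ᵥ vpt α β π T := by
  simpa only [dotProduct_vpt_eq_add, add_le_add_iff_left] using sum_treeCoeff_mul_le hβ hT hT' h

theorem dotProduct_vpt_eq_iff_isAdapted (hβ : StrictMono β) (hT : T ∈ treesInternal d d)
    (hT' : T' ∈ treesInternal d d) (h : T.IsAdapted (gap (w ∘ π.symm))) :
    w ⬝ᵥ vpt α β π T' = w ⬝ᵥ vpt α β π T ↔ T'.IsAdapted (gap (w ∘ π.symm)) := by
  simpa only [dotProduct_vpt_eq_add, add_right_inj] using sum_treeCoeff_mul_eq_iff hβ hT hT' h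

theorem SortedAdapted.dotProduct_vpt_le (h : SortedAdapted w π T) (hβ : StrictMono β)
    (hc : ∀ T ∈ treesInternal d d, StrictMono (vpt α β 1 T)) (hT : T ∈ treesInternal d d)
    (hT' : T' ∈ treesInternal d d) : w ⬝ᵥ vpt α β π' T' ≤ w ⬝ᵥ vpt α β π T :=
  (dotProduct_vpt_le_of_monotone (hc T' hT').monotone h.1).trans
    (dotProduct_vpt_le_of_isAdapted hβ hT hT' h.2)

theorem SortedAdapted.dotProduct_vpt_eq_iff (h : SortedAdapted w π T) (hβ : StrictMono β)
    (hc : ∀ T ∈ treesInternal d d, StrictMono (vpt α β 1 T)) (hT : T ∈ treesInternal d d)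
    (hT' : T' ∈ treesInternal d d) :
    w ⬝ᵥ vpt α β π' T' = w ⬝ᵥ vpt α β π T ↔ SortedAdapted w π' T' := by
  have hperm : w ⬝ᵥ vpt α β π' T' ≤ w ⬝ᵥ vpt α β π T' :=
    dotProduct_vpt_le_of_monotone (hc T' hT').monotone h.1
  have htree : w ⬝ᵥ vpt α β π T' ≤ w ⬝ᵥ vpt α β π T :=
    dotProduct_vpt_le_of_isAdapted hβ hT hT' h.2
  have heq : w ⬝ᵥ vpt α β π' T' = w ⬝ᵥ vpt α β π T ↔
      w ⬝ᵥ vpt α β π' T' = w ⬝ᵥ vpt α β π T' ∧ w ⬝ᵥ vpt α β π T' = w ⬝ᵥ vpt α β π T :=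
    ⟨fun h => ⟨hperm.antisymm (htree.trans_eq h.symm), htree.antisymm (h.symm.trans_le hperm)⟩,
      fun h => h.1.trans h.2⟩
  rw [heq, dotProduct_vpt_eq_iff_monotone (hc T' hT') h.1,
    dotProduct_vpt_eq_iff_isAdapted hβ hT hT' h.2]
  refine and_congr_right fun hw => ?_
  rw [Tuple.unique_monotone h.1 hw]

theorem vpt_mem_maximizers_iff (hβ : StrictMono β)
    (hc : ∀ T ∈ treesInternal d d, StrictMono (vpt α β 1 T)) (hT : T ∈ treesInternal d d) :
    vpt α β π T ∈ maximizers (permAssoPoints α β) (dotProductEquiv ℝ (Fin (d + 1)) w) ↔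
      SortedAdapted w π T := by
  constructor
  · rintro ⟨-, hmax⟩
    obtain ⟨σ, R, hR, h⟩ := exists_sortedAdapted w
    exact (h.dotProduct_vpt_eq_iff hβ hc hR hT).1
      ((h.dotProduct_vpt_le hβ hc hR hT).antisymm (hmax _ ⟨σ, R, hR, rfl⟩))
  · refine fun h => ⟨⟨π, T, hT, rfl⟩, ?_⟩
    rintro _ ⟨π', T', hT', rfl⟩
    exact h.dotProduct_vpt_le hβ hc hT hT'

/-! ### The nested permuto-associahedron -/

theorem PartitionLabeledTree.IsInterior.cone_eq_maxCone {X : PartitionLabeledTree d}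
    (h : X.IsInterior w₀) (hβ : StrictMono β)
    (hc : ∀ T ∈ treesInternal d d, StrictMono (vpt α β 1 T)) :
    X.cone = maxCone (pointFunctional (permAssoPoints_subset_U (α := α) (β := β)))
      (Submodule.Quotient.mk w₀) := by
  ext w
  obtain ⟨w, rfl⟩ := Submodule.Quotient.mk_surjective _ w
  rw [h.mk_mem_cone_iff, mk_mem_maxCone_pointFunctional_iff]
  constructor
  · rintro hsub _ hv
    obtain ⟨π, T, hT, rfl⟩ := hv.1
    rw [vpt_mem_maximizers_iff hβ hc hT] at hv ⊢
    exact hsub π T hT hv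
  · intro hsub π T hT hπT
    rw [← vpt_mem_maximizers_iff hβ hc hT] at hπT ⊢
    exact hsub hπT

theorem nestedLodayFan_eq_range_maxCone (hβ : StrictMono β)
    (hc : ∀ T ∈ treesInternal d d, StrictMono (vpt α β 1 T)) :
    nestedLodayFan d =
      Set.range (maxCone (pointFunctional (permAssoPoints_subset_U (α := α) (β := β)))) := by
  ext C
  constructor
  · rintro ⟨X, rfl⟩
    obtain ⟨w₀, hX⟩ := X.exists_isInterior
    exact ⟨_, (hX.cone_eq_maxCone hβ hc).symm⟩
  · rintro ⟨w₀, rfl⟩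
    obtain ⟨w₀, rfl⟩ := Submodule.Quotient.mk_surjective _ w₀
    obtain ⟨X, hX⟩ := PartitionLabeledTree.exists_isInterior_of_vector w₀
    exact ⟨X, hX.cone_eq_maxCone hβ hc⟩

theorem normalFan_permAsso (hβ : StrictMono β)
    (hc : ∀ T ∈ treesInternal d d, StrictMono (vpt α β 1 T)) :
    normalFan (permAsso α β) = nestedLodayFan d := by
  rw [nestedLodayFan_eq_range_maxCone hβ hc, permAsso, normalFan_convexHull]

theorem permCone_eq_ncone (hβ : StrictMono β)
    (hc : ∀ T ∈ treesInternal d d, StrictMono (vpt α β 1 T)) (π : Equiv.Perm (Fin (d + 1)))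
    (hT : T ∈ treesInternal d d) :
    permCone π T hT.1 = ncone {vpt α β π T} (permAsso α β) := by
  have hv : vpt α β π T ∈ permAssoPoints α β := ⟨π, T, hT, rfl⟩
  ext w
  obtain ⟨w, rfl⟩ := Submodule.Quotient.mk_surjective _ w
  rw [mk_mem_permCone_iff, permAsso,
    mk_mem_ncone_iff (Set.singleton_subset_iff.2 (subset_convexHull ℝ _ hv))
      (convexHull_subset_U permAssoPoints_subset_U),
    Set.singleton_subset_iff, mem_maximizers_convexHull_iff hv,
    vpt_mem_maximizers_iff hβ hc hT]

theorem vpt_eq_of_sortedAdapted (hT : T ∈ treesInternal d d) (hT' : T' ∈ treesInternal d d)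
    (hw₀ : PartitionLabeledTree.IsInterior ⟨d, permPartition π, T, hT.1⟩ w₀)
    (h : SortedAdapted w₀ π' T') : vpt α β π' T' = vpt α β π T := by
  obtain ⟨u₀, hu₀, hcart, rfl⟩ := hw₀
  simp only [OrderedPartition.blockIndex_permPartition] at *
  obtain rfl : π' = π := by
    have hmono : Monotone (π'.symm.trans π) := fun i j hij => hu₀.le_iff_le.1 (h.1 hij)
    exact Equiv.symm_bijective.injective
      (Equiv.trans_eq_refl_iff_eq_symm.1 ((Equiv.Perm.monotone_iff _).1 hmono))
  have hadapted : T'.IsAdapted (gap u₀) := by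
    simpa only [Function.comp_assoc, Equiv.self_comp_symm, Function.comp_id] using h.2
  have hcoeff : treeCoeff β T' = treeCoeff β T :=
    treeCoeff_congr β hT' hT fun i j =>
      (hcart.labelLE_iff_of_isAdapted hT hT'.1 hadapted i j)
  rw [vpt, vpt, hcoeff]

theorem vertexSet_permAsso (hβ : StrictMono β)
    (hc : ∀ T ∈ treesInternal d d, StrictMono (vpt α β 1 T)) :
    vertexSet (permAsso α β) = permAssoPoints α β := by
  rw [permAsso, vertexSet_convexHull]
  ext v
  constructor
  · rintro ⟨l, hl⟩
    exact (hl.ge rfl).1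
  · rintro ⟨π, T, hT, rfl⟩
    obtain ⟨w₀, hw₀⟩ :=
      PartitionLabeledTree.exists_isInterior ⟨d, permPartition π, T, hT.1⟩
    refine ⟨dotProductEquiv ℝ _ w₀, Set.eq_singleton_iff_unique_mem.2 ⟨?_, fun v hv => ?_⟩⟩
    · rw [vpt_mem_maximizers_iff hβ hc hT]
      exact mk_mem_permCone_iff.1 (hw₀.mk_mem_cone_iff.2 fun _ _ _ h => h)
    · obtain ⟨π', T', hT', rfl⟩ := hv.1
      exact vpt_eq_of_sortedAdapted hT hT' hw₀ ((vpt_mem_maximizers_iff hβ hc hT').1 hv)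

theorem affineSpan_permAsso (hc : ∀ T ∈ treesInternal d d, StrictMono (vpt α β 1 T)) :
    (affineSpan ℝ (permAsso α β) : Set (Fin (d + 1) → ℝ)) = U α := by
  obtain ⟨-, T, hT, -⟩ := exists_sortedAdapted (0 : Fin (d + 1) → ℝ)
  rw [permAsso, affineSpan_convexHull]
  exact affineSpan_eq_U permAssoPoints_subset_U (hc T hT).injective
    fun π => ⟨π, T, hT, (vpt_eq_comp ..).symm⟩

end PermAsso

end NestedPermAsso

theorem proposition6p4_general (d : ℕ) (α : Fin (d + 1) → ℝ) (β : Fin d → ℝ)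
    (hβ : StrictMono β) (hc : ∀ T ∈ treesInternal d d, StrictMono (vpt α β 1 T)) :
    ((affineSpan ℝ (permAsso α β) : Set (Fin (d + 1) → ℝ)) = U α ∧
      vertexSet (permAsso α β) = permAssoPoints α β) ∧
    (∀ (π : Equiv.Perm (Fin (d + 1))) (T : PlaneTree) (hT : T ∈ treesInternal d d),
      permCone π T hT.1 = ncone {vpt α β π T} (permAsso α β)) ∧
    (normalFan (permAsso α β) = nestedLodayFan d ∧
      IsFan (nestedLodayFan d) ∧ IsCompleteFan (nestedLodayFan d) ∧
      IsProjective (nestedLodayFan d)) := by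
  have hfan := normalFan_permAsso hβ hc
  refine ⟨⟨affineSpan_permAsso hc, vertexSet_permAsso hβ hc⟩,
    fun π T hT => permCone_eq_ncone hβ hc π hT, hfan, ?_⟩
  rw [← hfan]
  exact ⟨isFan_normalFan_convexHull permAssoPoints_subset_U,
    isCompleteFan_normalFan_convexHull permAssoPoints_subset_U,
    isProjective_normalFan_convexHull permAssoPoints_subset_U⟩

theorem proposition6p4 (d : ℕ) (α : Fin (d + 1) → ℝ) (β : Fin d → ℝ)
    (hαβ : IsTreeAppropriate α β) :
    ((affineSpan ℝ (permAsso α β) : Set (Fin (d + 1) → ℝ)) = U α ∧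
      vertexSet (permAsso α β) = permAssoPoints α β) ∧
    (∀ (π : Equiv.Perm (Fin (d + 1))) (T : PlaneTree) (hT : T ∈ treesInternal d d),
      permCone π T hT.1 = ncone {vpt α β π T} (permAsso α β)) ∧
    (normalFan (permAsso α β) = nestedLodayFan d ∧
      IsFan (nestedLodayFan d) ∧ IsCompleteFan (nestedLodayFan d) ∧
      IsProjective (nestedLodayFan d)) :=
  proposition6p4_general d α β hαβ.strictMono_snd fun T hT => hαβ.strictMono_coeff T hT 1
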